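/- **Discretization Lemma.** Let $G$ be a finite, simple, connected graph with at least one edge. *Points and distances.* Every edge of $G$ is regarded as a segment of length $1$. The point set $P(G)$ consists of the points $p(u,v,\lambda)$ for $uv\in E(G)$ and $\lambda\in[0,1]$, where $p(u,v,\lambda)=p(v,u,1-\lambda)$, and where $p(u,v,0)$ is the vertex $u$ and $p(u,v,1)$ is the vertex $v$. A *walk* is a finite sequence of points $T=\langle p_0,p_1,\dots,p_z\rangle$ with $z\ge 0$ in which any two consecutive points are distinct and lie on a common edge. The $p_i$ are its *stopping points*. Its length $\ell(T)$ is the sum over $i\in[z]=\{1,\dots,z\}$ of the distances $|\lambda-\mu|$ between $p_{i-1}=p(u,v,\lambda)$ and $p_i=p(u,v,\mu)$ on their common edge $uv$. The set $P(T)$ of points *passed* by $T$ consists of the stopping points and of all points lying between $p_{i-1}$ and $p_i$ on their common edge, for $i\in[z]$. The distance $d(p,q)$ of two points is the least length of a walk from $p$ to $q$. *Tours.* A *tour* is a walk with $p_0=p_z$. For $\delta\ge 0$, a *$\delta$-tour* is a tour $T$ with $\inf_{q\in P(T)}d(p,q)\le\delta$ for every $p\in P(G)$. A *shortest* $\delta$-tour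 is a $\delta$-tour whose length is minimum among all $\delta$-tours of $G$. A tour *traverses* an edge $uv$ at step $i\in[z]$ if $\{p_{i-1},p_i\}=\{u,v\}$. A tour is *nice* if $z\ge 3$ and 1. for every $i\in[z]$, at least one of $p_{i-1},p_i$ is a vertex; 2. for every $i\in[z]$ such that $p_i$ is not a vertex, $p_{i-1}=p_{(i+1)\bmod z}$; 3. for every edge $uv$ there is at most one $i\in[z]$ with $p_i\in\{p(u,v,\lambda):\lambda\in(0,1)\}$; 4. if $T$ traverses an edge $uv$, then there is no $i\in[z]$ with $p_i\in\{p(u,v,\lambda):\lambda\in(0,1)\}$; 5. every edge is traversed at most twice, that is, at no more than two steps. *Statement.* For every real $\delta\ge 0$, the graph $G$ has a shortest $\delta$-tour $T$ that is nice or has at most two stopping points, and such that every stopping point of $T$ can be written as $p(u,v,\lambda)$ with $uv\in E(G)$ and $\lambda\in S_\delta$, where $$S_\delta=\Big\{0,\ \delta-\lfloor\delta\rfloor,\ \tfrac12+\delta-\lfloor\tfrac12+\delta\rfloor,\ 2\delta-\lfloor2\delta\rfloor\Big\}.$$ -/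

import Mathlib

open scoped ENNReal

noncomputable section

namespace ContinuousGraph

open Classical in
/-- The point `p(u,v,lam)` at distance `lam` from `u` on the unit-length edge `uv`, written in
barycentric coordinates: the formal combination `(1 - lam) · u + lam · v` of vertices.
For real points of edges, the only coincidences are `p(u,v,lam) = p(v,u,1-lam)` and those of
endpoints that are the same vertex (see `edgePt_eq_iff`). -/
def edgePt {V : Type*} (u v : V) (lam : ℝ) : V → ℝ :=
  fun w => (if w = u then 1 - lam else 0) + (if w = v then lam else 0)

open Classical in
/-- The vertex `v`, as a point. -/
def vertexPt {V : Type*} (v : V) : V → ℝ :=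
  fun w => if w = v then 1 else 0

theorem edgePt_swap {V : Type*} (u v : V) (lam : ℝ) :
    edgePt u v lam = edgePt v u (1 - lam) := by
  funext w
  simp only [edgePt, sub_sub_cancel]
  exact add_comm _ _

theorem edgePt_zero {V : Type*} (u v : V) : edgePt u v 0 = vertexPt u := by
  funext w
  simp [edgePt, vertexPt]

theorem edgePt_one {V : Type*} (u v : V) : edgePt u v 1 = vertexPt v := by
  funext w
  simp [edgePt, vertexPt]

/-- Two descriptions give the same point exactly when they agree, agree after reversing the edge,
or both describe the same vertex. -/
theorem edgePt_eq_iff {V : Type*} {u v u' v' : V} (h : u ≠ v) (h' : u' ≠ v') {a b : ℝ}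
    (ha : a ∈ Set.Icc (0 : ℝ) 1) (hb : b ∈ Set.Icc (0 : ℝ) 1) :
    edgePt u v a = edgePt u' v' b ↔
      (u = u' ∧ v = v' ∧ a = b) ∨ (u = v' ∧ v = u' ∧ a = 1 - b) ∨
      ∃ x, ((u = x ∧ a = 0) ∨ (v = x ∧ a = 1)) ∧ ((u' = x ∧ b = 0) ∨ (v' = x ∧ b = 1)) := by
  constructor
  · intro e
    have e1 := congrFun e u
    have e2 := congrFun e v
    have e3 := congrFun e u'
    have e4 := congrFun e v'
    obtain ⟨ha0, ha1⟩ := ha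
    obtain ⟨hb0, hb1⟩ := hb
    simp only [edgePt] at e1 e2 e3 e4
    suffices key : (u = u' ∧ v = v' ∧ a = b) ∨ (u = v' ∧ v = u' ∧ a = 1 - b) ∨
        (u = u' ∧ a = 0 ∧ b = 0) ∨ (u = v' ∧ a = 0 ∧ b = 1) ∨
        (v = u' ∧ a = 1 ∧ b = 0) ∨ (v = v' ∧ a = 1 ∧ b = 1) by
      rcases key with k | k | ⟨k, ka, kb⟩ | ⟨k, ka, kb⟩ | ⟨k, ka, kb⟩ | ⟨k, ka, kb⟩
      · exact Or.inl k
      · exact Or.inr (Or.inl k)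
      · exact Or.inr (Or.inr ⟨u, Or.inl ⟨rfl, ka⟩, Or.inl ⟨k.symm, kb⟩⟩)
      · exact Or.inr (Or.inr ⟨u, Or.inl ⟨rfl, ka⟩, Or.inr ⟨k.symm, kb⟩⟩)
      · exact Or.inr (Or.inr ⟨v, Or.inr ⟨rfl, ka⟩, Or.inl ⟨k.symm, kb⟩⟩)
      · exact Or.inr (Or.inr ⟨v, Or.inr ⟨rfl, ka⟩, Or.inr ⟨k.symm, kb⟩⟩)
    clear e
    by_cases h1 : u = u' <;> by_cases h2 : v = v' <;> by_cases h3 : u = v' <;>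
      by_cases h4 : v = u' <;> grind
  · rintro (⟨rfl, rfl, rfl⟩ | ⟨rfl, rfl, rfl⟩ | ⟨x, (⟨rfl, rfl⟩ | ⟨rfl, rfl⟩),
      (⟨h1, rfl⟩ | ⟨h1, rfl⟩)⟩)
    · rfl
    · rw [edgePt_swap, sub_sub_cancel]
    all_goals subst h1; simp only [edgePt_zero, edgePt_one]

/-- The point set `P(G)`. -/
def points {V : Type*} (G : SimpleGraph V) : Set (V → ℝ) :=
  {p | ∃ (u v : V) (lam : ℝ), G.Adj u v ∧ lam ∈ Set.Icc (0 : ℝ) 1 ∧ p = edgePt u v lam}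

/-- The points in the interior of the edge `uv`. -/
def openEdge {V : Type*} (u v : V) : Set (V → ℝ) :=
  {p | ∃ lam ∈ Set.Ioo (0 : ℝ) 1, p = edgePt u v lam}

/-- The point is a vertex. -/
def IsVertex {V : Type*} (p : V → ℝ) : Prop := ∃ v : V, p = vertexPt v

/-- The edge segment between two points of a common edge: all points of that edge
between them. -/
def edgeSegment {V : Type*} (G : SimpleGraph V) (p q : V → ℝ) : Set (V → ℝ) :=
  {x | ∃ (u v : V) (a b c : ℝ), G.Adj u v ∧ a ∈ Set.Icc (0 : ℝ) 1 ∧ b ∈ Set.Icc (0 : ℝ) 1 ∧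
    p = edgePt u v a ∧ q = edgePt u v b ∧ min a b ≤ c ∧ c ≤ max a b ∧ x = edgePt u v c}

/-- The distance of two points of a common edge, as the maximal difference of their
coordinates; by `edgeDist_edgePt` this is the difference of the edge positions. It is only used for
points of a common edge. -/
def edgeDist {V : Type*} [Fintype V] (p q : V → ℝ) : ℝ := dist p q

theorem edgeDist_edgePt {V : Type*} [Fintype V] {u v : V} (h : u ≠ v) (a b : ℝ) :
    edgeDist (edgePt u v a) (edgePt u v b) = |b - a| := by
  apply le_antisymm
  · refine (dist_pi_le_iff (abs_nonneg _)).2 fun w => ?_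
    rw [Real.dist_eq]
    simp only [edgePt]
    by_cases h1 : w = u
    · have h2 : w ≠ v := fun h2 => h (h1.symm.trans h2)
      simp [h1, h]
    · by_cases h2 : w = v
      · simp [h2, h.symm, abs_sub_comm]
      · simp [h1, h2]
  · have := dist_le_pi_dist (edgePt u v a) (edgePt u v b) v
    rw [Real.dist_eq] at this
    simpa [edgePt, h.symm, abs_sub_comm, edgeDist] using this

/-- A walk `p_0 p_1 … p_z` with `z = len`: a finite sequence of points such that any two consecutive
ones are distinct points of a common edge. Only the values `pt 0, …, pt len` are relevant. -/
structure Walk {V : Type*} (G : SimpleGraph V) where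
  len : ℕ
  pt : ℕ → V → ℝ
  mem_points : ∀ i ≤ len, pt i ∈ points G
  step : ∀ i < len, ∃ (u v : V) (a b : ℝ), G.Adj u v ∧ a ∈ Set.Icc (0 : ℝ) 1 ∧
    b ∈ Set.Icc (0 : ℝ) 1 ∧ a ≠ b ∧ pt i = edgePt u v a ∧ pt (i + 1) = edgePt u v b

namespace Walk

/-- The length of a walk. -/
def length {V : Type*} [Fintype V] {G : SimpleGraph V} (T : Walk G) : ℝ :=
  ∑ i ∈ Finset.range T.len, edgeDist (T.pt i) (T.pt (i + 1))

/-- The set of stopping points `p_0, …, p_z`. -/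
def stops {V : Type*} {G : SimpleGraph V} (T : Walk G) : Set (V → ℝ) :=
  {p | ∃ i ≤ T.len, p = T.pt i}

/-- The set of points passed by the walk: the edge segments between consecutive stopping points,
and the stopping points themselves (which only matters if the walk consists of one point). -/
def passed {V : Type*} {G : SimpleGraph V} (T : Walk G) : Set (V → ℝ) :=
  T.stops ∪ {x | ∃ i < T.len, x ∈ edgeSegment G (T.pt i) (T.pt (i + 1))}

/-- A tour is a closed walk. -/
def IsTour {V : Type*} {G : SimpleGraph V} (T : Walk G) : Prop := T.pt 0 = T.pt T.len

/-- The step from `pt i` to `pt (i+1)` traverses the edge `uv`, in one of the two directions. -/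
def TraversesAt {V : Type*} {G : SimpleGraph V} (T : Walk G) (u v : V) (i : ℕ) : Prop :=
  (T.pt i = vertexPt u ∧ T.pt (i + 1) = vertexPt v) ∨
    (T.pt i = vertexPt v ∧ T.pt (i + 1) = vertexPt u)

/-- Nice tours. The steps are `pt i, pt (i+1)` for `i < len`. -/
structure IsNice {V : Type*} {G : SimpleGraph V} (T : Walk G) : Prop where
  isTour : T.IsTour
  three_le : 3 ≤ T.len
  /-- no two consecutive stopping points inside an edge -/
  vertex_or : ∀ i < T.len, IsVertex (T.pt i) ∨ IsVertex (T.pt (i + 1))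
  /-- around a stopping point inside an edge, the previous and the next one agree (cyclically) -/
  turn : ∀ i < T.len, ¬ IsVertex (T.pt (i + 1)) → T.pt i = T.pt ((i + 2) % T.len)
  /-- at most one stop inside any edge -/
  interior_once : ∀ u v : V, G.Adj u v → ∀ i ∈ Set.Icc 1 T.len, ∀ j ∈ Set.Icc 1 T.len,
    T.pt i ∈ openEdge u v → T.pt j ∈ openEdge u v → i = j
  /-- no stop inside a traversed edge -/
  interior_of_traversed : ∀ u v : V, G.Adj u v → (∃ i < T.len, T.TraversesAt u v i) →
    ∀ i ∈ Set.Icc 1 T.len, T.pt i ∉ openEdge u v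
  /-- every edge is traversed at most twice -/
  traversed_le : ∀ u v : V, G.Adj u v → {i | i < T.len ∧ T.TraversesAt u v i}.ncard ≤ 2

end Walk

/-- The distance of two points: the least length of a walk between them, `∞` if there is none. -/
def pointDist {V : Type*} [Fintype V] (G : SimpleGraph V) (p q : V → ℝ) : ℝ≥0∞ :=
  ⨅ (W : Walk G) (_ : W.pt 0 = p) (_ : W.pt W.len = q), ENNReal.ofReal W.length

/-- The distance of a point to a set of points. -/
def setDist {V : Type*} [Fintype V] (G : SimpleGraph V) (p : V → ℝ) (Q : Set (V → ℝ)) : ℝ≥0∞ :=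
  ⨅ q ∈ Q, pointDist G p q

/-- A `δ`-tour: a tour such that each point of the graph has distance at most `δ` to it. -/
def IsDeltaTour {V : Type*} [Fintype V] (G : SimpleGraph V) (δ : ℝ) (T : Walk G) : Prop :=
  T.IsTour ∧ ∀ p ∈ points G, setDist G p T.passed ≤ ENNReal.ofReal δ

/-- A shortest `δ`-tour. -/
def IsShortestDeltaTour {V : Type*} [Fintype V] (G : SimpleGraph V) (δ : ℝ) (T : Walk G) : Prop :=
  IsDeltaTour G δ T ∧ ∀ T' : Walk G, IsDeltaTour G δ T' → T.length ≤ T'.length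

/-- The set `S_δ` of edge positions. -/
def positions (δ : ℝ) : Set ℝ :=
  {0, δ - ⌊δ⌋, 1 / 2 + δ - ⌊1 / 2 + δ⌋, 2 * δ - ⌊2 * δ⌋}

end ContinuousGraph

end

open scoped ENNReal

noncomputable section

namespace ContinuousGraph

/-! The idea is to describe a tour by finitely many real parameters, to express the `δ`-condition as
inequalities in them, and to round the parameters without making the tour longer.

If a tour stops at a vertex, `exists_closed_walk_cover` replaces it by a closed walk of `G`, no
longer in total, with stubs: excursions from vertices of the walk into incident edges and back.
`exists_walk_count_le_two` then removes surplus uses of edges in pairs. A tour that stops at no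
vertex stays inside one edge (`exists_interval_of_no_vertex`). What is left free are the lengths `y
e` of the gaps, the unvisited parts of edges, and the length of the tour decreases as their sum
grows.

An unvisited point that is farthest from the tour lies half-way between two ways of reaching the
tour. Hence the `δ`-condition says that certain pairs of gaps satisfy `y e + y f + n ≤ 2 * δ` with
an integer `n` made of graph distances. Necessity (`IsGapData.gapsClose`) uses a 1-Lipschitz
function as a lower bound for distances, sufficiency (`IsGapData.setDist_le`) uses explicit walks.

Substituting `y = δ + z` turns these constraints into `z + z' ≤ m` with integers `m`. They are
preserved by every monotone odd map that commutes with integer translations. `exists_rounding` takes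
such a step map whose values modulo `1` are `0`, `±θ` and `1/2`, where `θ` is the distance from `δ`
to the nearest integer. For a random threshold its expectation is the identity, so some threshold
does not decrease the sum of the gaps. The value `θ` makes the map fix `δ`; therefore integer gap
lengths stay fixed and gaps remain in `[0, 1]`.

The rounded walk with stubs is realized by a tour that is nice or has at most two stops
(`IsStubFamily.exists_tour`). So every `δ`-tour is at least as long as a discretized one with length
in the finite set `tourLengths`, and a minimum exists. -/

/-! ### Randomized rounding of real numbers -/

/-- The monotone step function on `[0, 1/2]` with values `0, θ, 1/2` and threshold `s`. -/
def stepHalf (θ s r : ℝ) : ℝ :=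
  if r < θ then (if r ≤ s * θ then 0 else θ)
  else (if r ≤ θ + s * (1 / 2 - θ) then θ else 1 / 2)

/-- The odd extension of `stepHalf` to `[-1/2, 1/2]`. -/
def stepOdd (θ s r : ℝ) : ℝ :=
  if 0 ≤ r then stepHalf θ s r else - stepHalf θ s (-r)

/-- The extension of `stepOdd` to the real line that commutes with integer translations. -/
def stepReal (θ s z : ℝ) : ℝ := round z + stepOdd θ s (z - round z)

section
variable {θ s : ℝ}

theorem stepHalf_zero (hθ : 0 ≤ θ) (hθ' : θ ≤ 1 / 2) (hs : 0 < s) : stepHalf θ s 0 = 0 := by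
  unfold stepHalf
  split_ifs with h1 h2 h2
  · rfl
  · exact absurd (by positivity) h2
  · linarith
  · exact absurd (by nlinarith) h2

theorem stepHalf_self (hθ' : θ ≤ 1 / 2) (hs : 0 < s) : stepHalf θ s θ = θ := by
  unfold stepHalf
  rw [if_neg (lt_irrefl _), if_pos (by nlinarith)]

theorem stepHalf_half (hθ' : θ ≤ 1 / 2) (hs' : s < 1) :
    stepHalf θ s (1 / 2) = 1 / 2 := by
  unfold stepHalf
  rw [if_neg (by linarith)]
  split_ifs with h
  · nlinarith
  · rfl

theorem stepHalf_nonneg (hθ : 0 ≤ θ) (r : ℝ) : 0 ≤ stepHalf θ s r := by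
  unfold stepHalf; split_ifs <;> linarith

theorem stepHalf_le (hθ' : θ ≤ 1 / 2) (r : ℝ) : stepHalf θ s r ≤ 1 / 2 := by
  unfold stepHalf; split_ifs <;> linarith

theorem stepHalf_mono (hθ : 0 ≤ θ) (hθ' : θ ≤ 1 / 2) : Monotone (stepHalf θ s) := by
  intro a b hab
  unfold stepHalf; split_ifs <;> linarith

theorem stepOdd_neg (hθ : 0 ≤ θ) (hθ' : θ ≤ 1 / 2) (hs : 0 < s) (r : ℝ) :
    stepOdd θ s (-r) = - stepOdd θ s r := by
  unfold stepOdd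
  rcases lt_trichotomy r 0 with h | rfl | h
  · rw [if_pos (by linarith), if_neg (by linarith), neg_neg]
  · simp [stepHalf_zero hθ hθ' hs]
  · rw [if_neg (by linarith), if_pos (by linarith), neg_neg]

theorem stepOdd_mono (hθ : 0 ≤ θ) (hθ' : θ ≤ 1 / 2) : Monotone (stepOdd θ s) := by
  intro a b hab
  unfold stepOdd
  split_ifs with h1 h2 h2
  · exact stepHalf_mono hθ hθ' hab
  · linarith
  · linarith [stepHalf_nonneg (s := s) hθ (-a), stepHalf_nonneg (s := s) hθ b]
  · exact neg_le_neg (stepHalf_mono hθ hθ' (neg_le_neg hab))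

theorem stepOdd_half (hθ' : θ ≤ 1 / 2) (hs' : s < 1) :
    stepOdd θ s (1 / 2) = 1 / 2 := by
  rw [stepOdd, if_pos (by norm_num), stepHalf_half hθ' hs']

theorem abs_stepOdd_le (hθ : 0 ≤ θ) (hθ' : θ ≤ 1 / 2) (r : ℝ) : |stepOdd θ s r| ≤ 1 / 2 := by
  have h1 := stepHalf_nonneg (s := s) hθ
  have h2 := stepHalf_le (s := s) hθ'
  unfold stepOdd
  split_ifs
  · rw [abs_of_nonneg (h1 _)]; exact h2 _
  · rw [abs_neg, abs_of_nonneg (h1 _)]; exact h2 _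

/-- At a half-integer there are two nearest integers. Both give the same value, because `stepOdd`
fixes `1/2` and `-1/2`, so the tie-breaking of `round` is immaterial; oddness and translation
invariance rest on this. -/
theorem stepReal_eq (hθ : 0 ≤ θ) (hθ' : θ ≤ 1 / 2) (hs : 0 < s) (hs' : s < 1) {z : ℝ} {n : ℤ}
    (h : |z - n| ≤ 1 / 2) : stepReal θ s z = n + stepOdd θ s (z - n) := by
  have hr := abs_sub_round z
  unfold stepReal
  rw [abs_le] at h hr
  have h1 : (round z : ℝ) ≤ n + 1 := by linarith
  have h2 : (n : ℝ) ≤ round z + 1 := by linarith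
  have h1' : round z ≤ n + 1 := by exact_mod_cast h1
  have h2' : n ≤ round z + 1 := by exact_mod_cast h2
  have hh := stepOdd_half hθ' hs'
  have hh' : stepOdd θ s (-(1 / 2)) = -(1 / 2) := by rw [stepOdd_neg hθ hθ' hs, hh]
  obtain h3 | h3 | h3 : round z = n ∨ round z = n + 1 ∨ n = round z + 1 := by omega
  · rw [h3]
  · have h4 : (round z : ℝ) = n + 1 := by exact_mod_cast h3
    have h5 : z - n = 1 / 2 := by linarith
    have h6 : z - round z = -(1 / 2) := by linarith
    rw [h5, h6, hh, hh', h4]; ring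
  · have h4 : (n : ℝ) = round z + 1 := by exact_mod_cast h3
    have h5 : z - n = -(1 / 2) := by linarith
    have h6 : z - round z = 1 / 2 := by linarith
    rw [h5, h6, hh, hh', h4]; ring

theorem stepReal_neg (hθ : 0 ≤ θ) (hθ' : θ ≤ 1 / 2) (hs : 0 < s) (hs' : s < 1) (z : ℝ) :
    stepReal θ s (-z) = - stepReal θ s z := by
  have hr := abs_sub_round z
  have e : -z - ((-round z : ℤ) : ℝ) = -(z - round z) := by push_cast; ring
  rw [stepReal_eq hθ hθ' hs hs' (n := -round z) (by rw [e, abs_neg]; exact hr), e,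
    stepOdd_neg hθ hθ' hs, stepReal]
  push_cast; ring

theorem stepReal_add_int (hθ : 0 ≤ θ) (hθ' : θ ≤ 1 / 2) (hs : 0 < s) (hs' : s < 1) (z : ℝ)
    (n : ℤ) : stepReal θ s (z + n) = stepReal θ s z + n := by
  have hr := abs_sub_round z
  have e : z + n - ((round z + n : ℤ) : ℝ) = z - round z := by push_cast; ring
  rw [stepReal_eq hθ hθ' hs hs' (n := round z + n) (by rw [e]; exact hr), e, stepReal]
  push_cast; ring

theorem stepReal_mono (hθ : 0 ≤ θ) (hθ' : θ ≤ 1 / 2) :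
    Monotone (stepReal θ s) := by
  intro a b hab
  have ha := abs_le.1 (abs_stepOdd_le (s := s) hθ hθ' (a - round a))
  have hb := abs_le.1 (abs_stepOdd_le (s := s) hθ hθ' (b - round b))
  unfold stepReal
  rcases lt_trichotomy (round a) (round b) with h | h | h
  · have : (round a : ℝ) + 1 ≤ round b := by exact_mod_cast h
    linarith
  · rw [h]
    exact add_le_add le_rfl (stepOdd_mono hθ hθ' (by linarith))
  · exfalso
    have h1 : (round b : ℝ) + 1 ≤ round a := by exact_mod_cast h
    have h2 := abs_le.1 (abs_sub_round a)
    have h3 := abs_le.1 (abs_sub_round b)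
    have h4 : a = b := by linarith
    rw [h4] at h
    exact lt_irrefl _ h

end

/-- The average of the step functions over the threshold is the identity. -/
theorem integral_ite_lt {x : ℝ} (h0 : 0 ≤ x) (h1 : x ≤ 1) :
    ∫ s in Set.Ioo (0 : ℝ) 1, (if s < x then (1 : ℝ) else 0) = x := by
  have : (fun s : ℝ => if s < x then (1 : ℝ) else 0) = (Set.Iio x).indicator 1 := by
    funext s; simp [Set.indicator_apply]
  rw [this, MeasureTheory.integral_indicator_one measurableSet_Iio, MeasureTheory.Measure.real,
    MeasureTheory.Measure.restrict_apply measurableSet_Iio]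
  have : Set.Iio x ∩ Set.Ioo 0 1 = Set.Ioo 0 x := by
    ext y; simp only [Set.mem_inter_iff, Set.mem_Iio, Set.mem_Ioo]
    constructor
    · rintro ⟨a, b, c⟩; exact ⟨b, a⟩
    · rintro ⟨a, b⟩; exact ⟨b, a, by linarith⟩
  rw [this]; simp [h0]

theorem integrable_ite_lt (x : ℝ) :
    MeasureTheory.IntegrableOn (fun s : ℝ => if s < x then (1 : ℝ) else 0) (Set.Ioo 0 1) := by
  have : (fun s : ℝ => if s < x then (1 : ℝ) else 0) = (Set.Iio x).indicator 1 := by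
    funext s; simp [Set.indicator_apply]
  rw [this]
  exact (MeasureTheory.integrable_const (1 : ℝ)).indicator measurableSet_Iio

/-- Write `r = c + g * x` between two neighbouring values `c` and `c + g`. The step function rounds
`r` up exactly for the thresholds `s < x`, which have probability `x`. -/
theorem stepHalf_average {θ r : ℝ} (hθ' : θ ≤ 1 / 2) (h0 : 0 ≤ r) (h1 : r ≤ 1 / 2) :
    MeasureTheory.IntegrableOn (fun s => stepHalf θ s r) (Set.Ioo 0 1) ∧
      ∫ s in Set.Ioo (0 : ℝ) 1, stepHalf θ s r = r := by
  obtain ⟨c, g, x, hx0, hx1, hr, hf⟩ : ∃ c g x : ℝ, 0 ≤ x ∧ x ≤ 1 ∧ r = c + g * x ∧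
      (fun s => stepHalf θ s r) = fun s => c + g * (if s < x then 1 else 0) := by
    by_cases h : r < θ
    · have hθ0 : 0 < θ := h0.trans_lt h
      refine ⟨0, θ, r / θ, by positivity, (div_le_one hθ0).2 h.le, by field_simp; ring, ?_⟩
      funext s
      rw [stepHalf, if_pos h]
      by_cases h2 : s < r / θ
      · rw [if_pos h2, if_neg (by rw [lt_div_iff₀ hθ0] at h2; linarith)]; ring
      · rw [if_neg h2, if_pos (by rw [lt_div_iff₀ hθ0] at h2; linarith)]; ring
    · by_cases h3 : θ = 1 / 2
      · have : r = 1 / 2 := by linarith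
        refine ⟨1 / 2, 0, 0, le_rfl, zero_le_one, by linarith, ?_⟩
        funext s
        rw [stepHalf, if_neg h, h3]
        simp
      · have hg : 0 < 1 / 2 - θ := by
          have := lt_of_le_of_ne hθ' h3
          linarith
        refine ⟨θ, 1 / 2 - θ, (r - θ) / (1 / 2 - θ), div_nonneg (by linarith) hg.le,
          (div_le_one hg).2 (by linarith), ?_, ?_⟩
        · rw [mul_div_cancel₀ _ hg.ne']; ring
        · funext s
          rw [stepHalf, if_neg h]
          by_cases h2 : s < (r - θ) / (1 / 2 - θ)
          · rw [if_pos h2, if_neg (by rw [lt_div_iff₀ hg] at h2; linarith)]; ring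
          · rw [if_neg h2, if_pos (by rw [lt_div_iff₀ hg] at h2; linarith)]; ring
  have hi := (integrable_ite_lt x).const_mul g
  rw [hf]
  refine ⟨(MeasureTheory.integrable_const c).add hi, ?_⟩
  rw [MeasureTheory.integral_add (MeasureTheory.integrable_const c) hi,
    MeasureTheory.integral_const_mul, integral_ite_lt hx0 hx1, hr]
  simp

theorem stepReal_average {θ : ℝ} (hθ' : θ ≤ 1 / 2) (z : ℝ) :
    MeasureTheory.IntegrableOn (fun s => stepReal θ s z) (Set.Ioo 0 1) ∧
      ∫ s in Set.Ioo (0 : ℝ) 1, stepReal θ s z = z := by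
  have hr := abs_le.1 (abs_sub_round z)
  have key : MeasureTheory.IntegrableOn (fun s => stepOdd θ s (z - round z)) (Set.Ioo 0 1) ∧
      ∫ s in Set.Ioo (0 : ℝ) 1, stepOdd θ s (z - round z) = z - round z := by
    unfold stepOdd
    split_ifs with h
    · exact stepHalf_average hθ' h hr.2
    · obtain ⟨h1, h2⟩ := stepHalf_average (r := -(z - round z)) hθ' (by linarith) (by linarith)
      refine ⟨h1.neg, ?_⟩
      rw [MeasureTheory.integral_neg, h2, neg_neg]
  unfold stepReal
  refine ⟨(MeasureTheory.integrable_const _).add key.1, ?_⟩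
  rw [MeasureTheory.integral_add (MeasureTheory.integrable_const _) key.1, key.2]
  simp

/-- The reals that are congruent modulo `1` to an element of `positions δ`. -/
def grid (δ : ℝ) : Set ℝ :=
  {y | ∃ n : ℤ, y = n ∨ y = δ + n ∨ y = 1 / 2 + δ + n ∨ y = 2 * δ + n}

/-- A rounding of the reals to `grid δ` that respects the constraints of a `δ`-tour and does not
decrease the sum of a given finite family. -/
theorem exists_rounding (δ : ℝ) {ι : Type*} (I : Finset ι) (y : ι → ℝ) :
    ∃ Φ : ℝ → ℝ, Monotone Φ ∧
      (∀ n : ℤ, Φ n = n) ∧ (∀ (a b : ℝ) (n : ℤ), a + b ≤ 2 * δ + n → Φ a + Φ b ≤ 2 * δ + n) ∧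
      (∀ x, Φ x ∈ grid δ) ∧ ∑ i ∈ I, y i ≤ ∑ i ∈ I, Φ (y i) := by
  set m : ℤ := round δ with hm
  -- With this intermediate value the step function fixes `δ`, whatever the threshold.
  set θ : ℝ := |δ - m| with hθdef
  have hθ : 0 ≤ θ := abs_nonneg _
  have hθ' : θ ≤ 1 / 2 := abs_sub_round δ
  obtain ⟨s, ⟨hs, hs'⟩, hsum⟩ : ∃ s ∈ Set.Ioo (0 : ℝ) 1,
      ∑ i ∈ I, (y i - δ) ≤ ∑ i ∈ I, stepReal θ s (y i - δ) := by
    have hint : ∀ i ∈ I, MeasureTheory.Integrable (fun s => stepReal θ s (y i - δ))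
        (MeasureTheory.volume.restrict (Set.Ioo 0 1)) :=
      fun i _ => (stepReal_average hθ' (y i - δ)).1
    have h1 : ∫ s in Set.Ioo (0 : ℝ) 1, ∑ i ∈ I, stepReal θ s (y i - δ) =
        ∑ i ∈ I, (y i - δ) := by
      rw [MeasureTheory.integral_finsetSum _ hint]
      exact Finset.sum_congr rfl fun i _ => (stepReal_average hθ' (y i - δ)).2
    have : MeasureTheory.IsProbabilityMeasure
        (MeasureTheory.volume.restrict (Set.Ioo (0 : ℝ) 1)) := ⟨by simp⟩
    -- Some threshold does at least as well as the mean; excluding the null set outside `(0, 1)`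
    -- keeps the threshold strictly inside.
    obtain ⟨s, hs, h⟩ := MeasureTheory.exists_notMem_null_integral_le
      (MeasureTheory.integrable_finsetSum _ hint)
      (N := (Set.Ioo (0 : ℝ) 1)ᶜ) (MeasureTheory.ae_restrict_mem measurableSet_Ioo)
    rw [h1] at h
    exact ⟨s, not_not.1 hs, h⟩
  have hneg := stepReal_neg hθ hθ' hs hs'
  have hadd := stepReal_add_int hθ hθ' hs hs'
  have hmono := stepReal_mono (s := s) hθ hθ'
  have hδ : stepReal θ s δ = δ := by
    have : stepOdd θ s (δ - m) = δ - m := by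
      rcases le_total 0 (δ - m) with h | h
      · have e : δ - m = θ := (abs_of_nonneg h).symm
        rw [e, stepOdd, if_pos hθ, stepHalf_self hθ' hs]
      · have e : δ - m = -θ := by rw [hθdef, abs_of_nonpos h, neg_neg]
        rw [e, stepOdd_neg hθ hθ' hs, stepOdd, if_pos hθ, stepHalf_self hθ' hs]
    rw [stepReal, ← hm, this]; ring
  refine ⟨fun x => δ + stepReal θ s (x - δ), fun a b h => ?_, fun n => ?_,
    fun a b n h => ?_, fun x => ?_, ?_⟩
  · exact add_le_add le_rfl (hmono (by linarith))
  · dsimp only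
    -- An integer is a translate of `-δ` in the shifted coordinate, and `-δ` is fixed by oddness.
    rw [show (n : ℝ) - δ = -δ + n by ring, hadd, hneg, hδ]; ring
  -- In the shifted coordinate the constraint compares one value with a translate of the negative of
  -- the other.
  · have h1 := hmono (show a - δ ≤ -(b - δ) + n by linarith)
    rw [hadd, hneg] at h1
    dsimp only
    linarith
  · have h1 : stepOdd θ s (x - δ - round (x - δ)) ∈ ({0, θ, -θ, 1 / 2, -(1 / 2)} : Set ℝ) := by
      unfold stepOdd stepHalf
      split_ifs <;> simp
    dsimp only [stepReal]
    set k := round (x - δ)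
    have h2 : θ = δ - m ∨ θ = -(δ - m) := abs_choice _
    simp only [Set.mem_insert_iff, Set.mem_singleton_iff] at h1
    have hp : ∀ t, t = δ - m → δ + ((k : ℝ) + t) ∈ grid δ := fun t ht =>
      ⟨k - m, Or.inr (Or.inr (Or.inr (by rw [ht]; push_cast; ring)))⟩
    have hn : ∀ t, t = -(δ - m) → δ + ((k : ℝ) + t) ∈ grid δ := fun t ht =>
      ⟨k + m, Or.inl (by rw [ht]; push_cast; ring)⟩
    rcases h1 with h | h | h | h | h
    · exact ⟨k, Or.inr (Or.inl (by rw [h]; ring))⟩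
    · rcases h2 with h2 | h2
      · exact hp _ (by rw [h, h2])
      · exact hn _ (by rw [h, h2])
    · rcases h2 with h2 | h2
      · exact hn _ (by rw [h, h2])
      · exact hp _ (by rw [h, h2, neg_neg])
    · exact ⟨k, Or.inr (Or.inr (Or.inl (by rw [h]; ring)))⟩
    · exact ⟨k - 1, Or.inr (Or.inr (Or.inl (by rw [h]; push_cast; ring)))⟩
  · rw [Finset.sum_sub_distrib] at hsum
    rw [Finset.sum_add_distrib]
    have : ∑ i ∈ I, (fun _ => δ) i = ∑ i ∈ I, δ := rfl
    linarith

/-- The value `1` is kept apart since the elements of `positions δ` are fractional parts;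
`exists_position` disposes of it later. -/
theorem mem_positions_of_mem_grid {δ y : ℝ} (h : y ∈ grid δ) (h0 : 0 ≤ y) (h1 : y ≤ 1) :
    y = 1 ∨ y ∈ positions δ := by
  rcases h1.lt_or_eq with h1 | h1
  · right
    have hf : Int.fract y = y := Int.fract_eq_self.2 ⟨h0, h1⟩
    obtain ⟨n, h | h | h | h⟩ := h
    · left
      rw [← hf, h, Int.fract_intCast]
    · right; left
      rw [Int.self_sub_floor, ← hf, h, Int.fract_add_intCast]
    · right; right; left
      rw [Int.self_sub_floor, ← hf, h, Int.fract_add_intCast]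
    · right; right; right
      rw [Set.mem_singleton_iff, Int.self_sub_floor, ← hf, h, Int.fract_add_intCast]
  · exact Or.inl h1

theorem positions_finite (δ : ℝ) : (positions δ).Finite := by
  unfold positions; exact Set.toFinite _

/-! ### Points, and lower bounds on distances by potentials -/

section
variable {V : Type*} {G : SimpleGraph V}

theorem edgePt_mem_points {u v : V} {a : ℝ} (h : G.Adj u v) (ha : a ∈ Set.Icc (0 : ℝ) 1) :
    edgePt u v a ∈ points G := ⟨u, v, a, h, ha, rfl⟩

theorem one_sub_mem_Icc {a : ℝ} (ha : a ∈ Set.Icc (0 : ℝ) 1) : 1 - a ∈ Set.Icc (0 : ℝ) 1 :=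
  ⟨by linarith [ha.2], by linarith [ha.1]⟩

/-- A function of edge positions that is compatible with the identification of positions. -/
structure IsPotential (G : SimpleGraph V) (h : V → V → ℝ → ℝ) : Prop where
  swap : ∀ u v a, G.Adj u v → h u v a = h v u (1 - a)
  vertex : ∀ u v v', G.Adj u v → G.Adj u v' → h u v 0 = h u v' 0
  lipschitz : ∀ u v, G.Adj u v → ∀ a ∈ Set.Icc (0 : ℝ) 1, ∀ b ∈ Set.Icc (0 : ℝ) 1,
    h u v a - h u v b ≤ |b - a|

theorem IsPotential.congr {h : V → V → ℝ → ℝ} (H : IsPotential G h) {u v u' v' : V} {a b : ℝ}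
    (hu : G.Adj u v) (hu' : G.Adj u' v') (ha : a ∈ Set.Icc (0 : ℝ) 1)
    (hb : b ∈ Set.Icc (0 : ℝ) 1) (e : edgePt u v a = edgePt u' v' b) : h u v a = h u' v' b := by
  rcases (edgePt_eq_iff hu.ne hu'.ne ha hb).1 e with ⟨rfl, rfl, rfl⟩ | ⟨rfl, rfl, rfl⟩ |
    ⟨x, (⟨rfl, rfl⟩ | ⟨rfl, rfl⟩), (⟨h1, rfl⟩ | ⟨h1, rfl⟩)⟩
  · rfl
  · rw [H.swap _ _ _ hu, sub_sub_cancel]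
  · subst h1; exact H.vertex _ _ _ hu hu'
  · subst h1; rw [H.swap u' v' 1 hu', sub_self]; exact H.vertex _ _ _ hu hu'.symm
  · subst h1; rw [H.swap u _ 1 hu, sub_self]; exact H.vertex _ _ _ hu.symm hu'
  · subst h1; rw [H.swap u _ 1 hu, H.swap u' _ 1 hu', sub_self]
    exact H.vertex _ _ _ hu.symm hu'.symm

variable [Fintype V]

/-- By `IsPotential.congr` the potential is a function of points. Its differences along the walk
telescope, and each is at most the length of its step. -/
theorem IsPotential.sub_le_length {h : V → V → ℝ → ℝ} (H : IsPotential G h) (W : Walk G)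
    {u v u' v' : V} {a b : ℝ} (hu : G.Adj u v) (hu' : G.Adj u' v') (ha : a ∈ Set.Icc (0 : ℝ) 1)
    (hb : b ∈ Set.Icc (0 : ℝ) 1) (e : W.pt 0 = edgePt u v a)
    (e' : W.pt W.len = edgePt u' v' b) : h u v a - h u' v' b ≤ W.length := by
  classical
  obtain ⟨f, hf⟩ : ∃ f : (V → ℝ) → ℝ, ∀ u v a, G.Adj u v → a ∈ Set.Icc (0 : ℝ) 1 →
      f (edgePt u v a) = h u v a := by
    refine ⟨fun p => if hp : p ∈ points G then h hp.choose hp.choose_spec.choose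
      hp.choose_spec.choose_spec.choose else 0, fun u v a hu ha => ?_⟩
    have hp : edgePt u v a ∈ points G := edgePt_mem_points hu ha
    have hs := hp.choose_spec.choose_spec.choose_spec
    refine (dif_pos hp).trans ?_
    exact H.congr hs.1 hu hs.2.1 ha hs.2.2.symm
  rw [← hf u v a hu ha, ← hf u' v' b hu' hb, ← e, ← e',
    ← Finset.sum_range_sub' (fun i => f (W.pt i))]
  refine Finset.sum_le_sum fun i hi => ?_
  obtain ⟨x, y, c, d, hxy, hc, hd, -, e1, e2⟩ := W.step i (Finset.mem_range.1 hi)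
  rw [e1, e2, hf x y c hxy hc, hf x y d hxy hd, edgeDist_edgePt hxy.ne]
  exact H.lipschitz x y hxy c hc d hd

/-- This is how the `δ`-condition is exploited: it bounds every potential that is nonpositive on the
visited part. -/
theorem IsPotential.le_of_setDist_le {h : V → V → ℝ → ℝ} (H : IsPotential G h)
    {Q : Set (V → ℝ)} (hQ : ∀ p ∈ Q, ∃ u v a, G.Adj u v ∧ a ∈ Set.Icc (0 : ℝ) 1 ∧
      p = edgePt u v a ∧ h u v a ≤ 0)
    {δ : ℝ} (hδ : 0 ≤ δ) {u v : V} {a : ℝ} (hu : G.Adj u v) (ha : a ∈ Set.Icc (0 : ℝ) 1)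
    (hd : setDist G (edgePt u v a) Q ≤ ENNReal.ofReal δ) : h u v a ≤ δ := by
  refine (ENNReal.ofReal_le_ofReal_iff hδ).1 (le_trans ?_ hd)
  refine le_iInf₂ fun q hq => le_iInf fun W => le_iInf fun e1 => le_iInf fun e2 => ?_
  obtain ⟨x, y, b, hxy, hb, rfl, h2⟩ := hQ q hq
  refine ENNReal.ofReal_le_ofReal ?_
  have h1 := H.sub_le_length W hu hxy ha hb e1 e2
  linarith

/-! ### Upper bounds on distances -/

/-- Prolong a walk by a step at its beginning. -/
def Walk.cons {V : Type*} {G : SimpleGraph V} (W : Walk G) {u v : V} {a b : ℝ} (hu : G.Adj u v)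
    (ha : a ∈ Set.Icc (0 : ℝ) 1) (hb : b ∈ Set.Icc (0 : ℝ) 1) (hab : a ≠ b)
    (e : W.pt 0 = edgePt u v b) : Walk G where
  len := W.len + 1
  pt i := Nat.casesOn i (edgePt u v a) W.pt
  mem_points i hi := by
    cases i with
    | zero => exact edgePt_mem_points hu ha
    | succ i => exact W.mem_points i (by omega)
  step i hi := by
    cases i with
    | zero => exact ⟨u, v, a, b, hu, ha, hb, hab, rfl, e⟩
    | succ i => exact W.step i (by omega)

/-- The walk that stays at a point. -/
def Walk.single {V : Type*} {G : SimpleGraph V} (p : V → ℝ) (hp : p ∈ points G) : Walk G where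
  len := 0
  pt _ := p
  mem_points _ _ := hp
  step i hi := absurd hi (Nat.not_lt_zero i)

theorem setDist_eq_zero {Q : Set (V → ℝ)} {q : V → ℝ} (hq : q ∈ Q) (hq' : q ∈ points G) :
    setDist G q Q = 0 := by
  refine le_antisymm (iInf₂_le_of_le q hq ?_) zero_le
  refine iInf_le_of_le (Walk.single q hq') (iInf_le_of_le rfl (iInf_le_of_le rfl ?_))
  simp [Walk.length, Walk.single]

/-- Walks from the point at `b` are prolonged by the segment from `a`. The case `a = b` is separate
because steps must join distinct points. -/
theorem setDist_edgePt_le {Q : Set (V → ℝ)} {u v : V} (hu : G.Adj u v) {a b r s : ℝ}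
    (ha : a ∈ Set.Icc (0 : ℝ) 1) (hb : b ∈ Set.Icc (0 : ℝ) 1) (hr : 0 ≤ r)
    (h : setDist G (edgePt u v b) Q ≤ ENNReal.ofReal r) (hs : |b - a| + r ≤ s) :
    setDist G (edgePt u v a) Q ≤ ENNReal.ofReal s := by
  refine le_trans ?_ (ENNReal.ofReal_le_ofReal hs)
  by_cases hab : a = b
  · subst hab; simpa using h
  rw [ENNReal.ofReal_add (abs_nonneg _) hr]
  refine le_trans ?_ (add_le_add le_rfl h)
  rw [setDist, setDist, ENNReal.add_iInf]
  refine le_iInf fun q => ?_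
  by_cases hq : q ∈ Q
  swap
  · simp [hq]
  simp only [hq, iInf_pos]
  refine (iInf₂_le q hq).trans ?_
  rw [pointDist, pointDist, ENNReal.add_iInf]
  refine le_iInf fun W => ?_
  by_cases e1 : W.pt 0 = edgePt u v b
  swap
  · simp [e1]
  by_cases e2 : W.pt W.len = q
  swap
  · simp [e2]
  simp only [e1, e2, iInf_pos]
  refine iInf_le_of_le (W.cons hu ha hb hab e1) (iInf_le_of_le rfl (iInf_le_of_le e2 ?_))
  have hW : 0 ≤ W.length := Finset.sum_nonneg fun i _ => dist_nonneg
  rw [← ENNReal.ofReal_add (abs_nonneg _) hW]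
  refine ENNReal.ofReal_le_ofReal (le_of_eq ?_)
  change ∑ i ∈ Finset.range (W.len + 1), _ = _
  rw [Finset.sum_range_succ', add_comm]
  congr 1
  change edgeDist (edgePt u v a) (W.pt 0) = _
  rw [e1, edgeDist_edgePt hu.ne]

theorem setDist_vertexPt_le {Q : Set (V → ℝ)} {u v : V} (W : G.Walk u v) {r : ℝ} (hr : 0 ≤ r)
    (h : setDist G (vertexPt v) Q ≤ ENNReal.ofReal r) :
    setDist G (vertexPt u) Q ≤ ENNReal.ofReal (r + W.length) := by
  induction W with
  | nil => simpa using h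
  | cons hadj W ih =>
    rw [← edgePt_zero _ _]
    refine setDist_edgePt_le hadj (b := 1) (r := r + W.length) (by simp) (by simp)
      (by positivity) ?_ ?_
    · rw [edgePt_one]; exact ih h
    · simp; linarith

/-! ### Gaps -/

/-- `U` is a set of visited vertices, and for `B u v` the edge `uv` has an unvisited part of
length `y u v` at its unvisited end `v`. -/
structure IsGapData {V : Type*} (G : SimpleGraph V) (U : V → Prop) (B : V → V → Prop)
    (y : V → V → ℝ) : Prop where
  adj : ∀ u v, B u v → G.Adj u v
  not_visited : ∀ u v, B u v → ¬ U v
  boundary : ∀ u v, G.Adj u v → U u → ¬ U v → B u v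
  back : ∀ u v, B u v → U u ∨ B v u
  nonempty : ∀ v, ¬ U v → ∃ x w, B x w
  nonneg : ∀ u v, B u v → 0 ≤ y u v
  le_one : ∀ u v, B u v → y u v ≤ 1

/-- The inequalities that say that the gaps described by gap data are at distance at most `δ`. -/
structure GapsClose {V : Type*} (G : SimpleGraph V) (U : V → Prop) (B : V → V → Prop)
    (y : V → V → ℝ) (δ : ℝ) : Prop where
  gap : ∀ u v, B u v → ∃ x w, B x w ∧ y x w + G.dist w v + y u v ≤ 2 * δ
  edge : ∀ u v, G.Adj u v → ¬ U u → ¬ U v → ¬ B u v → ¬ B v u →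
    ∃ x w x' w', B x w ∧ B x' w' ∧
      y x w + G.dist w u + (y x' w' + G.dist w' v) + 1 ≤ 2 * δ

/-- The distance of a vertex to the visited part, measured through the gaps. -/
def gapDist {V : Type*} (G : SimpleGraph V) (B : V → V → Prop) (y : V → V → ℝ) (v : V) : ℝ :=
  ⨅ d : {d : V × V // B d.1 d.2}, (y d.1.1 d.1.2 + G.dist d.1.2 v)

section
variable {U : V → Prop} {B : V → V → Prop} {y : V → V → ℝ}

theorem gapDist_le {x w : V} (h : B x w) (v : V) : gapDist G B y v ≤ y x w + G.dist w v :=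
  ciInf_le (Set.finite_range _).bddBelow (⟨(x, w), h⟩ : {d : V × V // B d.1 d.2})

theorem exists_gapDist_eq (hB : ∃ x w, B x w) (v : V) :
    ∃ x w, B x w ∧ gapDist G B y v = y x w + G.dist w v := by
  obtain ⟨x, w, h⟩ := hB
  have : Nonempty {d : V × V // B d.1 d.2} := ⟨⟨(x, w), h⟩⟩
  obtain ⟨d, hd⟩ := exists_eq_ciInf_of_finite
    (f := fun d : {d : V × V // B d.1 d.2} => (y d.1.1 d.1.2 + (G.dist d.1.2 v : ℝ)))
  exact ⟨d.1.1, d.1.2, d.2, hd.symm⟩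

theorem gapDist_le_add (hB : ∃ x w, B x w) {u v : V} (h : G.Adj u v) (hG : G.Connected) :
    gapDist G B y u ≤ gapDist G B y v + 1 := by
  obtain ⟨x, w, hxw, e⟩ := exists_gapDist_eq (G := G) (y := y) hB v
  rw [e]
  have h1 := gapDist_le (G := G) (y := y) hxw u
  have h2 : G.dist w u ≤ G.dist w v + G.dist v u := hG.dist_triangle
  rw [SimpleGraph.dist_eq_one_iff_adj.2 h.symm] at h2
  have h3 : (G.dist w u : ℝ) ≤ G.dist w v + 1 := by exact_mod_cast h2
  linarith

theorem IsGapData.gapDist_nonneg {V : Type*} {G : SimpleGraph V} {U : V → Prop} {B : V → V → Prop}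
    {y : V → V → ℝ} (D : IsGapData G U B y) (v : V) : 0 ≤ gapDist G B y v :=
  Real.iInf_nonneg fun d => add_nonneg (D.nonneg _ _ d.2) (Nat.cast_nonneg _)

theorem gapDist_le_self {u v : V} (h : B u v) : gapDist G B y v ≤ y u v := by
  simpa using gapDist_le (G := G) (y := y) h v

open Classical in
/-- One half of the potential on an edge with a gap: distances in the gap at `v`. -/
def gapHalf {V : Type*} (G : SimpleGraph V) (B : V → V → Prop) (y : V → V → ℝ) (u v : V)
    (t : ℝ) : ℝ :=
  if B u v then min (gapDist G B y v + 1 - t) (t - (1 - y u v)) else 0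

open Classical in
/-- A lower bound for the distance to the visited part. -/
def gapPotential {V : Type*} (G : SimpleGraph V) (U : V → Prop) (B : V → V → Prop)
    (y : V → V → ℝ) (u v : V) (t : ℝ) : ℝ :=
  if U u ∧ U v then 0
  else if B u v ∨ B v u then max 0 (max (gapHalf G B y u v t) (gapHalf G B y v u (1 - t)))
  else min (gapDist G B y u + t) (gapDist G B y v + 1 - t)

theorem gapHalf_lipschitz {V : Type*} {G : SimpleGraph V} {B : V → V → Prop}
    {y : V → V → ℝ} (u v : V) (a b : ℝ) :
    gapHalf G B y u v a ≤ gapHalf G B y u v b + |b - a| := by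
  have h1 := le_abs_self (b - a)
  have h2 := neg_abs_le (b - a)
  unfold gapHalf
  split_ifs
  · rw [min_le_iff]
    rcases min_choice (gapDist G B y v + 1 - b) (b - (1 - y u v)) with e | e <;> rw [e]
    · left; linarith
    · right; linarith
  · linarith [abs_nonneg (b - a)]

/-- On each edge the function is built from terms of slope `0` or `±1` by minima and maxima. The
point at issue is agreement at vertices: all edges at `u` must give `0` if `u` is visited and
`gapDist G B y u` otherwise. -/
theorem IsGapData.isPotential (D : IsGapData G U B y) (hG : G.Connected) :
    IsPotential G (gapPotential G U B y) where
  swap u v a hu := by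
    unfold gapPotential
    rw [sub_sub_cancel, max_comm (gapHalf G B y u v a), min_comm,
      show gapDist G B y v + (1 - a) = gapDist G B y v + 1 - a by ring,
      show gapDist G B y u + 1 - (1 - a) = gapDist G B y u + a by ring]
    split_ifs <;> first | rfl | tauto
  vertex := by
    suffices ∀ u v, G.Adj u v → gapPotential G U B y u v 0 =
        open Classical in if U u then 0 else gapDist G B y u by
      intro u v v' h h'
      rw [this u v h, this u v' h']
    intro u v h
    have hn := D.gapDist_nonneg
    unfold gapPotential
    by_cases hu : U u
    · rw [if_pos hu]
      by_cases hv : U v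
      · rw [if_pos ⟨hu, hv⟩]
      · have hB := D.boundary _ _ h hu hv
        rw [if_neg (fun h => hv h.2), if_pos (Or.inl hB)]
        have h1 : ¬ B v u := fun h => D.not_visited _ _ h hu
        rw [gapHalf, gapHalf, if_pos hB, if_neg h1]
        refine max_eq_left (max_le ((min_le_right _ _).trans ?_) le_rfl)
        linarith [D.le_one _ _ hB]
    · rw [if_neg hu, if_neg (fun h => hu h.1)]
      by_cases hB : B u v ∨ B v u
      · have hvu : B v u := by
          rcases hB with hB | hB
          · exact (D.back _ _ hB).resolve_left hu
          · exact hB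
        rw [if_pos hB]
        have h1 : gapHalf G B y u v 0 ≤ 0 := by
          unfold gapHalf
          split_ifs with h1
          · exact (min_le_right _ _).trans (by linarith [D.le_one _ _ h1])
          · exact le_rfl
        have h2 : gapHalf G B y v u (1 - 0) = gapDist G B y u := by
          rw [gapHalf, if_pos hvu, min_eq_left]
          · ring
          · linarith [gapDist_le_self (G := G) (y := y) hvu]
        rw [h2, max_eq_right (h1.trans (hn u)), max_eq_right (hn u)]
      · rw [if_neg hB, add_zero, sub_zero, min_eq_left]
        exact gapDist_le_add (D.nonempty _ hu) h hG
  lipschitz u v hu a ha b hb := by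
    have h0 := abs_nonneg (b - a)
    have h1 := le_abs_self (b - a)
    have h2 := neg_abs_le (b - a)
    rw [sub_le_iff_le_add']
    unfold gapPotential
    split_ifs
    · linarith
    · refine max_le (by positivity) (max_le ?_ ?_)
      · refine (gapHalf_lipschitz u v a b).trans (add_le_add ?_ le_rfl)
        exact (le_max_left _ _).trans (le_max_right _ _)
      · refine (gapHalf_lipschitz v u (1 - a) (1 - b)).trans (add_le_add ?_ ?_)
        · exact (le_max_right _ _).trans (le_max_right _ _)
        · rw [abs_sub_comm]; exact le_of_eq (by congr 1; ring)
    · rw [min_le_iff]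
      rcases min_choice (gapDist G B y u + b) (gapDist G B y v + 1 - b) with e | e <;> rw [e]
      · left; linarith
      · right; linarith

/-- If the visited part `Q` is `δ`-close to all points, then the gaps satisfy the inequalities. -/
theorem IsGapData.gapsClose (D : IsGapData G U B y) (hG : G.Connected) {Q : Set (V → ℝ)}
    (hQ : ∀ p ∈ Q, ∃ u v a, G.Adj u v ∧ a ∈ Set.Icc (0 : ℝ) 1 ∧ p = edgePt u v a ∧
      ((U u ∧ U v) ∨ ((B u v ∨ B v u) ∧ (B u v → a ≤ 1 - y u v) ∧ (B v u → y v u ≤ a))))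
    {δ : ℝ} (hδ : 0 ≤ δ) (hd : ∀ p ∈ points G, setDist G p Q ≤ ENNReal.ofReal δ) :
    GapsClose G U B y δ := by
  have H := D.isPotential hG
  have hn := D.gapDist_nonneg
  have hle : ∀ u v a, G.Adj u v → a ∈ Set.Icc (0 : ℝ) 1 → gapPotential G U B y u v a ≤ δ := by
    intro u v a hu ha
    refine H.le_of_setDist_le (fun p hp => ?_) hδ hu ha (hd _ (edgePt_mem_points hu ha))
    obtain ⟨u, v, a, hu, ha, rfl, hq⟩ := hQ p hp
    refine ⟨u, v, a, hu, ha, rfl, ?_⟩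
    unfold gapPotential
    rcases hq with h | ⟨h1, h2, h3⟩
    · rw [if_pos h]
    · have : ¬ (U u ∧ U v) := by
        rintro ⟨hu, hv⟩
        exact h1.elim (fun h => D.not_visited _ _ h hv) (fun h => D.not_visited _ _ h hu)
      rw [if_neg this, if_pos h1]
      refine max_le le_rfl (max_le ?_ ?_) <;> unfold gapHalf <;> split_ifs with h
      · exact (min_le_right _ _).trans (by linarith [h2 h])
      · exact le_rfl
      · exact (min_le_right _ _).trans (by linarith [h3 h])
      · exact le_rfl
  constructor
  · intro u v hB
    obtain ⟨x, w, hxw, e⟩ := exists_gapDist_eq (G := G) (y := y) ⟨u, v, hB⟩ v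
    have h1 := hn v
    have h2 := gapDist_le_self (G := G) (y := y) hB
    have h3 := D.le_one _ _ hB
    -- The peak of the potential in the gap: entering the visited part at the near end of the gap or
    -- through `v` is equally long, namely half of `gapDist G B y v + y u v`.
    have h4 := hle u v (1 + (gapDist G B y v - y u v) / 2) (D.adj _ _ hB)
      ⟨by linarith, by linarith⟩
    rw [gapPotential, if_neg (fun h => D.not_visited _ _ hB h.2), if_pos (Or.inl hB)] at h4
    have h5 := ((le_max_left _ _).trans (le_max_right _ _)).trans h4
    rw [gapHalf, if_pos hB, min_eq_left (by linarith)] at h5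
    exact ⟨x, w, hxw, by linarith⟩
  · intro u v huv hu hv h1 h2
    have hne := D.nonempty _ hu
    obtain ⟨x, w, hxw, e⟩ := exists_gapDist_eq (G := G) (y := y) hne u
    obtain ⟨x', w', hxw', e'⟩ := exists_gapDist_eq (G := G) (y := y) hne v
    have h3 := gapDist_le_add (y := y) hne huv hG
    have h4 := gapDist_le_add (y := y) hne huv.symm hG
    -- Again the peak, where the routes through `u` and through `v` have equal bounds.
    have h5 := hle u v ((1 + gapDist G B y v - gapDist G B y u) / 2) huv
      ⟨by linarith, by linarith⟩
    rw [gapPotential, if_neg (fun h => hu h.1), if_neg (fun h => h.elim h1 h2),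
      min_eq_left (by linarith)] at h5
    exact ⟨x, w, x', w', hxw, hxw', by linarith⟩

/-- Conversely, the inequalities suffice. -/
theorem IsGapData.setDist_le (D : IsGapData G U B y) (hG : G.Connected) {Q : Set (V → ℝ)}
    {δ : ℝ}
    (hQ : ∀ u v a, G.Adj u v → a ∈ Set.Icc (0 : ℝ) 1 →
      (B u v ∨ B v u) → (B u v → a ≤ 1 - y u v) → (B v u → y v u ≤ a) → edgePt u v a ∈ Q)
    (hy : ∀ u v, B u v → B v u → y u v + y v u ≤ 1)
    (hU : ∀ u v a, G.Adj u v → U u → U v → a ∈ Set.Icc (0 : ℝ) 1 →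
      setDist G (edgePt u v a) Q ≤ ENNReal.ofReal δ)
    (hc : GapsClose G U B y δ) (p : V → ℝ) (hp : p ∈ points G) :
    setDist G p Q ≤ ENNReal.ofReal δ := by
  have hvert : ∀ x w v, B x w → setDist G (vertexPt v) Q ≤
      ENNReal.ofReal (y x w + G.dist w v) := by
    intro x w v hB
    have hadj := D.adj _ _ hB
    have h0 := D.nonneg _ _ hB
    have h1 := D.le_one _ _ hB
    obtain ⟨W, hW⟩ := hG.exists_walk_length_eq_dist v w
    rw [SimpleGraph.dist_comm, ← hW]
    refine setDist_vertexPt_le W h0 ?_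
    rw [← edgePt_one x w]
    refine setDist_edgePt_le hadj (b := 1 - y x w) (r := 0) (by simp)
      ⟨by linarith, by linarith⟩ le_rfl ?_ ?_
    · rw [setDist_eq_zero (hQ x w _ hadj ⟨by linarith, by linarith⟩ (Or.inl hB)
        (fun _ => le_rfl) (fun h => by linarith [hy _ _ hB h]))
        (edgePt_mem_points hadj ⟨by linarith, by linarith⟩)]
      exact zero_le
    · rw [abs_of_nonpos (by linarith)]; linarith
  have hgap : ∀ u v a, B u v → a ∈ Set.Icc (0 : ℝ) 1 → 1 - y u v ≤ a →
      setDist G (edgePt u v a) Q ≤ ENNReal.ofReal δ := by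
    intro u v a hB ha hya
    have hadj := D.adj _ _ hB
    obtain ⟨x, w, hxw, h⟩ := hc.gap u v hB
    have h0 := D.nonneg _ _ hB
    have h1 := D.le_one _ _ hB
    have h0' := D.nonneg _ _ hxw
    have hd0 : (0 : ℝ) ≤ G.dist w v := Nat.cast_nonneg _
    -- The route to the near end of the gap and the route through `v` have total length at most `2 *
    -- δ` by `h`, so one of them is at most `δ`.
    by_cases hcase : a - (1 - y u v) ≤ δ
    · refine setDist_edgePt_le hadj (b := 1 - y u v) (r := 0) ha ⟨by linarith, by linarith⟩
        le_rfl ?_ ?_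
      · rw [setDist_eq_zero (hQ u v _ hadj ⟨by linarith, by linarith⟩ (Or.inl hB)
          (fun _ => le_rfl) (fun h => by linarith [hy _ _ hB h]))
          (edgePt_mem_points hadj ⟨by linarith, by linarith⟩)]
        exact zero_le
      · rw [abs_of_nonpos (by linarith)]; linarith
    · refine setDist_edgePt_le hadj (b := 1) (r := y x w + G.dist w v) ha (by simp)
        (by positivity) ?_ ?_
      · rw [edgePt_one]; exact hvert x w v hxw
      · rw [abs_of_nonneg (by linarith [ha.2])]; linarith
  obtain ⟨u, v, a, huv, ha, rfl⟩ := hp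
  by_cases hUU : U u ∧ U v
  · exact hU u v a huv hUU.1 hUU.2 ha
  by_cases hB : B u v ∨ B v u
  · by_cases h1 : B u v ∧ 1 - y u v ≤ a
    · exact hgap u v a h1.1 ha h1.2
    by_cases h2 : B v u ∧ a ≤ y v u
    · rw [edgePt_swap]
      exact hgap v u _ h2.1 (one_sub_mem_Icc ha) (by linarith)
    rw [setDist_eq_zero (hQ u v a huv ha hB (fun h => ?_) (fun h => ?_))
      (edgePt_mem_points huv ha)]
    · exact zero_le
    · by_contra! h3; exact h1 ⟨h, h3.le⟩
    · by_contra! h3; exact h2 ⟨h, h3.le⟩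
  · have hu : ¬ U u := by
      intro hu
      by_cases hv : U v
      · exact hUU ⟨hu, hv⟩
      · exact hB (Or.inl (D.boundary _ _ huv hu hv))
    have hv : ¬ U v := by
      intro hv
      exact hB (Or.inr (D.boundary _ _ huv.symm hv hu))
    obtain ⟨x, w, x', w', hxw, hxw', h⟩ :=
      hc.edge u v huv hu hv (fun h => hB (Or.inl h)) (fun h => hB (Or.inr h))
    have h0 := D.nonneg _ _ hxw
    have h0' := D.nonneg _ _ hxw'
    have hd0 : (0 : ℝ) ≤ G.dist w u := Nat.cast_nonneg _
    have hd0' : (0 : ℝ) ≤ G.dist w' v := Nat.cast_nonneg _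
    by_cases hcase : a + (y x w + G.dist w u) ≤ δ
    · refine setDist_edgePt_le huv (b := 0) (r := y x w + G.dist w u) ha (by simp)
        (by positivity) ?_ ?_
      · rw [edgePt_zero]; exact hvert x w u hxw
      · rw [abs_of_nonpos (by linarith [ha.1])]; linarith
    · refine setDist_edgePt_le huv (b := 1) (r := y x' w' + G.dist w' v) ha (by simp)
        (by positivity) ?_ ?_
      · rw [edgePt_one]; exact hvert x' w' v hxw'
      · rw [abs_of_nonneg (by linarith [ha.2])]; linarith

/-- Each inequality bounds a sum of two gap lengths by `2 * δ` plus an integer, so it survives with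
the same gaps as witnesses. -/
theorem GapsClose.round {V : Type*} {G : SimpleGraph V} {U : V → Prop} {B : V → V → Prop}
    {y : V → V → ℝ} {δ : ℝ} (hc : GapsClose G U B y δ) {Φ : ℝ → ℝ}
    (hadd : ∀ (a b : ℝ) (n : ℤ), a + b ≤ 2 * δ + n → Φ a + Φ b ≤ 2 * δ + n) :
    GapsClose G U B (fun u v => Φ (y u v)) δ where
  gap u v hB := by
    obtain ⟨x, w, hxw, h⟩ := hc.gap u v hB
    refine ⟨x, w, hxw, ?_⟩
    have := hadd (y x w) (y u v) (-(G.dist w v : ℤ)) (by push_cast; linarith)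
    push_cast at this
    linarith
  edge u v huv hu hv h1 h2 := by
    obtain ⟨x, w, x', w', hxw, hxw', h⟩ := hc.edge u v huv hu hv h1 h2
    refine ⟨x, w, x', w', hxw, hxw', ?_⟩
    have := hadd (y x w) (y x' w') (-(G.dist w u + G.dist w' v + 1 : ℤ)) (by push_cast; linarith)
    push_cast at this
    linarith

theorem GapsClose.mono {V : Type*} {G : SimpleGraph V} {U : V → Prop} {B : V → V → Prop}
    {y : V → V → ℝ} {δ : ℝ} (hc : GapsClose G U B y δ) {y' : V → V → ℝ}
    (hle : ∀ u v, B u v → y' u v ≤ y u v) : GapsClose G U B y' δ where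
  gap u v hB := by
    obtain ⟨x, w, hxw, h⟩ := hc.gap u v hB
    exact ⟨x, w, hxw, by linarith [hle _ _ hB, hle _ _ hxw]⟩
  edge u v huv hu hv h1 h2 := by
    obtain ⟨x, w, x', w', hxw, hxw', h⟩ := hc.edge u v huv hu hv h1 h2
    exact ⟨x, w, x', w', hxw, hxw', by linarith [hle _ _ hxw, hle _ _ hxw']⟩

end

end

/-! ### From a tour to a closed walk with stubs, or to an interval -/

section
variable {V : Type*} {G : SimpleGraph V}

/-- Two distinct points lie on at most one common edge, which makes segments independent of the
chosen coordinates. -/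
theorem edgePt_unique {u v u' v' : V} (h : u ≠ v) (h' : u' ≠ v') {a b a' b' : ℝ} (hab : a ≠ b)
    (ha : a ∈ Set.Icc (0 : ℝ) 1) (hb : b ∈ Set.Icc (0 : ℝ) 1)
    (ha' : a' ∈ Set.Icc (0 : ℝ) 1) (hb' : b' ∈ Set.Icc (0 : ℝ) 1)
    (e : edgePt u v a = edgePt u' v' a') (e' : edgePt u v b = edgePt u' v' b') :
    (u = u' ∧ v = v' ∧ a = a' ∧ b = b') ∨ (u = v' ∧ v = u' ∧ a = 1 - a' ∧ b = 1 - b') := by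
  rw [edgePt_eq_iff h h' ha ha'] at e
  rw [edgePt_eq_iff h h' hb hb'] at e'
  grind

theorem mem_edgeSegment_edgePt {u v : V} (h : G.Adj u v) {a b : ℝ} (hab : a ≠ b)
    (ha : a ∈ Set.Icc (0 : ℝ) 1) (hb : b ∈ Set.Icc (0 : ℝ) 1) {x : V → ℝ} :
    x ∈ edgeSegment G (edgePt u v a) (edgePt u v b) ↔
      ∃ c, min a b ≤ c ∧ c ≤ max a b ∧ x = edgePt u v c := by
  constructor
  · rintro ⟨u', v', a', b', c, h', ha', hb', e, e', h1, h2, rfl⟩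
    rcases edgePt_unique h.ne h'.ne hab ha hb ha' hb' e e' with
      ⟨rfl, rfl, rfl, rfl⟩ | ⟨rfl, rfl, rfl, rfl⟩
    · exact ⟨c, h1, h2, rfl⟩
    · refine ⟨1 - c, ?_, ?_, edgePt_swap _ _ _⟩
      · rw [min_le_iff]
        rcases le_max_iff.1 h2 with h | h
        · left; linarith
        · right; linarith
      · rw [le_max_iff]
        rcases min_le_iff.1 h1 with h | h
        · left; linarith
        · right; linarith
  · rintro ⟨c, h1, h2, rfl⟩
    exact ⟨u, v, a, b, c, h, ha, hb, rfl, rfl, h1, h2, rfl⟩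

theorem isVertex_edgePt_iff {u v : V} (h : u ≠ v) {a : ℝ} (ha : a ∈ Set.Icc (0 : ℝ) 1) :
    IsVertex (edgePt u v a) ↔ a = 0 ∨ a = 1 := by
  constructor
  · rintro ⟨w, hw⟩
    by_contra! hcon
    have h1 := congrFun hw u
    have h2 := congrFun hw v
    simp only [edgePt, vertexPt, h, h.symm, if_true, if_false] at h1 h2
    grind
  · rintro (rfl | rfl)
    · exact ⟨u, edgePt_zero u v⟩
    · exact ⟨v, edgePt_one u v⟩

/-- A step of a walk, seen from a given edge position of its first point. -/
theorem exists_step_eq {u v u' v' : V} {t a b : ℝ} (h : G.Adj u v) (h' : G.Adj u' v')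
    (ht : t ∈ Set.Icc (0 : ℝ) 1) (ht1 : t < 1) (ha : a ∈ Set.Icc (0 : ℝ) 1)
    (hb : b ∈ Set.Icc (0 : ℝ) 1) (hab : a ≠ b) (e : edgePt u v t = edgePt u' v' a) :
    ∃ w c, G.Adj u w ∧ c ∈ Set.Icc (0 : ℝ) 1 ∧ t ≠ c ∧ edgePt u w t = edgePt u' v' a ∧
      edgePt u w c = edgePt u' v' b ∧ (t = 0 ∨ w = v) := by
  rcases (edgePt_eq_iff h.ne h'.ne ht ha).1 e with ⟨rfl, rfl, rfl⟩ | ⟨rfl, rfl, rfl⟩ |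
    ⟨x, (⟨rfl, rfl⟩ | ⟨rfl, rfl⟩), (⟨h1, rfl⟩ | ⟨h1, rfl⟩)⟩
  · exact ⟨v, b, h, hb, hab, rfl, rfl, Or.inr rfl⟩
  · exact ⟨v, 1 - b, h, one_sub_mem_Icc hb, fun h => hab (by linarith), e,
      (edgePt_swap _ _ _).symm, Or.inr rfl⟩
  · subst h1
    exact ⟨v', b, h', hb, hab, rfl, rfl, Or.inl rfl⟩
  · subst h1
    refine ⟨u', 1 - b, h'.symm, one_sub_mem_Icc hb, fun h => hab (by linarith), ?_,
      (edgePt_swap _ _ _).symm, Or.inl rfl⟩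
    rw [edgePt_zero, edgePt_one]
  · exact absurd ht1 (lt_irrefl _)
  · exact absurd ht1 (lt_irrefl _)

/-- The points on the edges of a walk of the graph, or on stubs of lengths `a` at its vertices. -/
def cover {u v : V} (W : G.Walk u v) (a : V → V → ℝ) : Set (V → ℝ) :=
  {p | ∃ (x y : V) (c : ℝ), G.Adj x y ∧ c ∈ Set.Icc (0 : ℝ) 1 ∧ p = edgePt x y c ∧
    (s(x, y) ∈ W.edges ∨ (x ∈ W.support ∧ c ≤ a x y))}

variable [Fintype V]

/-- A walk from the vertex `o` to the point `p` of length at most `L` can be imitated by a walk of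
the graph with stubs. -/
def Imitable (G : SimpleGraph V) (o : V) (p : V → ℝ) (P : Set (V → ℝ)) (L : ℝ) : Prop :=
  ∃ (u v : V) (W : G.Walk o u) (a : V → V → ℝ) (t : ℝ), G.Adj u v ∧ p = edgePt u v t ∧
    0 ≤ t ∧ t ≤ a u v ∧ t < 1 ∧ (∀ x y, 0 ≤ a x y ∧ a x y ≤ 1) ∧ P ⊆ cover W a ∧
    W.length + 2 * ∑ x, ∑ y, a x y - t ≤ L

theorem sum_sum_update [DecidableEq V] (a : V → V → ℝ) (u v : V) (r : ℝ) :
    ∑ x, ∑ y, (if x = u ∧ y = v then r else a x y) = ∑ x, ∑ y, a x y + (r - a u v) := by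
  have : ∀ x y, (if x = u ∧ y = v then r else a x y) =
      a x y + if x = u then (if y = v then r - a u v else 0) else 0 := by
    intro x y
    by_cases h1 : x = u
    · by_cases h2 : y = v
      · simp [h1, h2]
      · simp [h2]
    · simp [h1]
  simp only [this, Finset.sum_add_distrib]
  simp

/-- The quantity `W.length + 2 * ∑ a - t` is an amortized cost: a growing stub is charged in both
directions, and `t` is the credit for the return not yet made. A step inside an edge extends the
stub to the farthest position reached. Arriving at the far end appends the edge to `W` and erases
the stub, which the new edge covers; this is cheap enough because the stub was at least `t` long. -/
theorem Imitable.step {o : V} {p q : V → ℝ} {P : Set (V → ℝ)} {L : ℝ} (H : Imitable G o p P L)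
    (hs : ∃ (u v : V) (a b : ℝ), G.Adj u v ∧ a ∈ Set.Icc (0 : ℝ) 1 ∧
      b ∈ Set.Icc (0 : ℝ) 1 ∧ a ≠ b ∧ p = edgePt u v a ∧ q = edgePt u v b) :
    Imitable G o q (P ∪ edgeSegment G p q) (L + edgeDist p q) := by
  classical
  obtain ⟨u, v, W, f, t, huv, rfl, ht0, htf, ht1, hf, hP, hL⟩ := H
  obtain ⟨u', v', a, b, huv', ha, hb, hab, e, rfl⟩ := hs
  obtain ⟨w, c, huw, hc, htc, e1, e2, hw⟩ :=
    exists_step_eq huv huv' ⟨ht0, ht1.le⟩ ht1 ha hb hab e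
  -- Only at a vertex, with `t = 0`, can the step change to another edge.
  have htw : t ≤ f u w := by
    rcases hw with h | h
    · rw [h]; exact (hf _ _).1
    · rw [h]; exact htf
  rw [e, ← e1, ← e2, edgeDist_edgePt huw.ne]
  have hseg : ∀ x ∈ edgeSegment G (edgePt u w t) (edgePt u w c),
      ∃ d ∈ Set.Icc (0 : ℝ) 1, d ≤ max t c ∧ x = edgePt u w d := by
    intro x hx
    obtain ⟨d, h1, h2, rfl⟩ := (mem_edgeSegment_edgePt huw htc ⟨ht0, ht1.le⟩ hc).1 hx
    exact ⟨d, ⟨(le_min ht0 hc.1).trans h1, h2.trans (max_le ht1.le hc.2)⟩, h2, rfl⟩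
  rcases hc.2.lt_or_eq with hc1 | rfl
  · refine ⟨u, w, W, fun x y => if x = u ∧ y = w then max (f u w) c else f x y, c, huw, rfl,
      hc.1, by simp, hc1, fun x y => ?_, ?_, ?_⟩
    · dsimp only
      split_ifs
      · exact ⟨(hf _ _).1.trans (le_max_left _ _), max_le (hf _ _).2 hc.2⟩
      · exact hf x y
    · rintro x (hx | hx)
      · obtain ⟨y, z, d, h1, h2, h3, h4⟩ := hP hx
        refine ⟨y, z, d, h1, h2, h3, h4.imp_right fun h => ⟨h.1, ?_⟩⟩
        dsimp only
        split_ifs with hh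
        · rw [hh.1, hh.2] at h
          exact h.2.trans (le_max_left _ _)
        · exact h.2
      · obtain ⟨d, h1, h2, rfl⟩ := hseg x hx
        refine ⟨u, w, d, huw, h1, rfl, Or.inr ⟨W.end_mem_support, ?_⟩⟩
        dsimp only
        rw [if_pos ⟨rfl, rfl⟩]
        exact h2.trans (max_le_max htw le_rfl)
    · rw [sum_sum_update]
      have h1 := le_abs_self (c - t)
      have h2 := neg_abs_le (c - t)
      rcases max_choice (f u w) c with h | h <;> rw [h] <;> linarith
  · refine ⟨w, u, W.concat huw, fun x y => if x = u ∧ y = w then 0 else f x y, 0, huw.symm, ?_,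
      le_rfl, ?_, zero_lt_one, fun x y => ?_, ?_, ?_⟩
    · rw [edgePt_zero, edgePt_one]
    · dsimp only
      split_ifs
      · exact le_rfl
      · exact (hf _ _).1
    · dsimp only
      split_ifs
      · exact ⟨le_rfl, zero_le_one⟩
      · exact hf x y
    · have hnew : ∀ d ∈ Set.Icc (0 : ℝ) 1, edgePt u w d ∈ cover (W.concat huw)
          (fun x y => if x = u ∧ y = w then 0 else f x y) := fun d hd =>
        ⟨u, w, d, huw, hd, rfl, Or.inl (by simp [SimpleGraph.Walk.edges_concat])⟩
      rintro x (hx | hx)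
      · obtain ⟨y, z, d, h1, h2, rfl, h4⟩ := hP hx
        by_cases hh : y = u ∧ z = w
        · rw [hh.1, hh.2]; exact hnew d h2
        · refine ⟨y, z, d, h1, h2, rfl, ?_⟩
          dsimp only
          rw [if_neg hh]
          refine h4.imp (fun h => ?_) fun h => ⟨?_, h.2⟩
          · simp [SimpleGraph.Walk.edges_concat, h]
          · simp [SimpleGraph.Walk.support_concat, h.1]
      · obtain ⟨d, h1, h2, rfl⟩ := hseg x hx
        exact hnew d h1
    · rw [sum_sum_update, SimpleGraph.Walk.length_concat, abs_of_nonneg (by linarith)]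
      push_cast
      linarith

theorem Imitable.run {T : Walk G} {o : V} {i j : ℕ} (hij : i ≤ j) (hj : j ≤ T.len)
    {P : Set (V → ℝ)} {L : ℝ} (H : Imitable G o (T.pt i) P L) :
    Imitable G o (T.pt j)
      (P ∪ {x | ∃ k, i ≤ k ∧ k < j ∧ x ∈ edgeSegment G (T.pt k) (T.pt (k + 1))})
      (L + ∑ k ∈ Finset.Ico i j, edgeDist (T.pt k) (T.pt (k + 1))) := by
  induction j, hij using Nat.le_induction with
  | base =>
    obtain ⟨u, v, W, a, t, h1, h2, h3, h4, h5, h6, h7, h8⟩ := H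
    refine ⟨u, v, W, a, t, h1, h2, h3, h4, h5, h6, ?_, by simpa using h8⟩
    rintro x (hx | ⟨k, hk, hk', -⟩)
    · exact h7 hx
    · omega
  | succ j hij ih =>
    obtain ⟨u, v, W, a, t, h1, h2, h3, h4, h5, h6, h7, h8⟩ :=
      (ih (by omega)).step (T.step j (by omega))
    refine ⟨u, v, W, a, t, h1, h2, h3, h4, h5, h6, ?_, ?_⟩
    · rintro x (hx | ⟨k, hk, hk', hx⟩)
      · exact h7 (Or.inl (Or.inl hx))
      · rcases (Nat.lt_succ_iff_lt_or_eq.1 hk') with h | rfl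
        · exact h7 (Or.inl (Or.inr ⟨k, hk, h, hx⟩))
        · exact h7 (Or.inr hx)
    · rw [Finset.sum_Ico_succ_top hij]
      linarith

theorem mem_edgeSegment_left {V : Type*} {G : SimpleGraph V} {p q : V → ℝ}
    (hs : ∃ (u v : V) (a b : ℝ), G.Adj u v ∧ a ∈ Set.Icc (0 : ℝ) 1 ∧
      b ∈ Set.Icc (0 : ℝ) 1 ∧ a ≠ b ∧ p = edgePt u v a ∧ q = edgePt u v b) :
    p ∈ edgeSegment G p q := by
  obtain ⟨u, v, a, b, h, ha, hb, -, h1, h2⟩ := hs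
  exact ⟨u, v, a, b, a, h, ha, hb, h1, h2, min_le_left _ _, le_max_left _ _, h1⟩

/-- A tour that stops at a vertex can be replaced by a closed walk of the graph with stubs. -/
theorem exists_closed_walk_cover (hV : ∀ v : V, ∃ w, G.Adj v w) {T : Walk G} (hT : T.IsTour)
    {k : ℕ} (hk : k ≤ T.len) {o : V} (ho : T.pt k = vertexPt o) :
    ∃ (W : G.Walk o o) (a : V → V → ℝ), (∀ x y, 0 ≤ a x y ∧ a x y ≤ 1) ∧
      T.passed ⊆ cover W a ∧ W.length + 2 * ∑ x, ∑ y, a x y ≤ T.length := by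
  obtain ⟨o', ho'⟩ := hV o
  have H0 : Imitable G o (T.pt k) {vertexPt o} 0 := by
    refine ⟨o, o', .nil, fun _ _ => 0, 0, ho', by rw [ho, edgePt_zero], le_rfl, le_rfl,
      zero_lt_one, by simp, ?_, by simp⟩
    rintro x rfl
    exact ⟨o, o', 0, ho', by simp, (edgePt_zero _ _).symm, Or.inr ⟨by simp, le_rfl⟩⟩
  -- The tour is followed from stop `k` to its end and, being closed, on from stop `0` back to stop
  -- `k`.
  have H1 := H0.run hk le_rfl
  rw [← hT] at H1
  have H2 := H1.run (Nat.zero_le k) hk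
  obtain ⟨u, v, W, a, t, h1, h2, h3, h4, h5, h6, h7, h8⟩ := H2
  rw [ho, ← edgePt_zero o o'] at h2
  -- Since `t < 1`, being back at `o` leaves only position `0` at `u`; thus the walk is closed and
  -- no credit remains.
  obtain ⟨rfl, rfl⟩ : o = u ∧ t = 0 := by
    rcases (edgePt_eq_iff ho'.ne h1.ne (by simp) ⟨h3, h5.le⟩).1 h2 with
      ⟨h, -, h'⟩ | ⟨-, -, h'⟩ | ⟨x, (⟨h, -⟩ | ⟨-, h⟩), (⟨h', h''⟩ | ⟨-, h'⟩)⟩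
    · exact ⟨h, h'.symm⟩
    · linarith
    · exact ⟨h.trans h'.symm, h''⟩
    all_goals linarith
  have hseg : ∀ l < T.len, ∀ x ∈ edgeSegment G (T.pt l) (T.pt (l + 1)), x ∈ cover W a := by
    intro l hl x hx
    rcases lt_or_ge l k with h | h
    · exact h7 (Or.inr ⟨l, Nat.zero_le _, h, hx⟩)
    · exact h7 (Or.inl (Or.inr ⟨l, h, hl, hx⟩))
  refine ⟨W, a, h6, ?_, ?_⟩
  · rintro x (⟨l, hl, rfl⟩ | ⟨l, hl, hx⟩)
    · have hmem : ∀ l < T.len, T.pt l ∈ cover W a := fun l hl =>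
        hseg l hl _ (mem_edgeSegment_left (T.step l hl))
      rcases hl.lt_or_eq with h | rfl
      · exact hmem l h
      · rw [← hT]
        rcases Nat.eq_zero_or_pos T.len with h0 | h0
        · have : k = 0 := by omega
          subst this
          exact h7 (Or.inl (Or.inl ho))
        · exact hmem 0 h0
    · exact hseg l hl x hx
  · have : ∑ k ∈ Finset.Ico k T.len, edgeDist (T.pt k) (T.pt (k + 1)) +
        ∑ k ∈ Finset.Ico 0 k, edgeDist (T.pt k) (T.pt (k + 1)) = T.length := by
      rw [Walk.length, Finset.range_eq_Ico, add_comm, Finset.sum_Ico_consecutive _ (by omega) hk]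
    linarith

/-- A tour that does not stop at a vertex stays inside one edge. -/
theorem exists_interval_of_no_vertex {T : Walk G} (hT : T.IsTour)
    (hv : ∀ i ≤ T.len, ¬ IsVertex (T.pt i)) :
    ∃ (u v : V) (α β : ℝ), G.Adj u v ∧ 0 ≤ α ∧ α ≤ β ∧ β ≤ 1 ∧
      (∀ x ∈ T.passed, ∃ c, α ≤ c ∧ c ≤ β ∧ x = edgePt u v c) ∧ 2 * (β - α) ≤ T.length := by
  obtain ⟨u, v, s, huv, hs, e⟩ := T.mem_points 0 (Nat.zero_le _)
  -- After `j` steps everything passed lies in `[α, β]`, which contains the start `s` and the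
  -- current position `t`. Sweeping the interval and returning to `s` costs at least `2 * (β - α)`,
  -- of which at most `|t - s|` is still outstanding.
  have key : ∀ j ≤ T.len, ∃ α β t, 0 ≤ α ∧ β ≤ 1 ∧ α ≤ s ∧ s ≤ β ∧ α ≤ t ∧ t ≤ β ∧
      T.pt j = edgePt u v t ∧
      (∀ i ≤ j, ∃ c, α ≤ c ∧ c ≤ β ∧ T.pt i = edgePt u v c) ∧
      (∀ i < j, ∀ x ∈ edgeSegment G (T.pt i) (T.pt (i + 1)),
        ∃ c, α ≤ c ∧ c ≤ β ∧ x = edgePt u v c) ∧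
      2 * (β - α) ≤ ∑ i ∈ Finset.range j, edgeDist (T.pt i) (T.pt (i + 1)) + |t - s| := by
    intro j
    induction j with
    | zero =>
      intro _
      refine ⟨s, s, s, hs.1, hs.2, le_rfl, le_rfl, le_rfl, le_rfl, e, fun i hi => ?_,
        fun i hi => absurd hi (Nat.not_lt_zero i), by simp⟩
      rw [Nat.le_zero.1 hi]
      exact ⟨s, le_rfl, le_rfl, e⟩
    | succ j ih =>
      intro hj
      obtain ⟨α, β, t, h1, h2, h3, h4, h5, h6, h7, h8, h9, h10⟩ := ih (by omega)
      obtain ⟨u', v', a, b, huv', ha, hb, hab, e1, e2⟩ := T.step j (by omega)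
      have htI : t ∈ Set.Icc (0 : ℝ) 1 := ⟨h1.trans h5, h6.trans h2⟩
      have hnv := hv j (by omega)
      rw [h7, isVertex_edgePt_iff huv.ne htI] at hnv
      push Not at hnv
      obtain ⟨w, c, huw, hc, htc, e3, e4, hw⟩ := exists_step_eq huv huv' htI
        (lt_of_le_of_ne htI.2 hnv.2) ha hb hab (h7.symm.trans e1)
      obtain rfl := hw.resolve_left hnv.1
      have hq : T.pt (j + 1) = edgePt u w c := by rw [e2, e4]
      have hm : ∀ d, α ≤ d ∧ d ≤ β → min α c ≤ d ∧ d ≤ max β c := fun d hd =>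
        ⟨(min_le_left _ _).trans hd.1, hd.2.trans (le_max_left _ _)⟩
      refine ⟨min α c, max β c, c, le_min h1 hc.1, max_le h2 hc.2,
        (hm s ⟨h3, h4⟩).1, (hm s ⟨h3, h4⟩).2, min_le_right _ _, le_max_right _ _, hq,
        fun i hi => ?_, fun i hi x hx => ?_, ?_⟩
      · rcases Nat.le_succ_iff.1 hi with h | rfl
        · obtain ⟨d, hd, hd', e⟩ := h8 i h
          exact ⟨d, (hm d ⟨hd, hd'⟩).1, (hm d ⟨hd, hd'⟩).2, e⟩
        · exact ⟨c, min_le_right _ _, le_max_right _ _, hq⟩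
      · rcases Nat.lt_succ_iff_lt_or_eq.1 hi with h | rfl
        · obtain ⟨d, hd, hd', e⟩ := h9 i h x hx
          exact ⟨d, (hm d ⟨hd, hd'⟩).1, (hm d ⟨hd, hd'⟩).2, e⟩
        · rw [h7, hq, mem_edgeSegment_edgePt huv htc htI hc] at hx
          obtain ⟨d, hd, hd', e⟩ := hx
          exact ⟨d, (min_le_min h5 le_rfl).trans hd, hd'.trans (max_le_max h6 le_rfl), e⟩
      · rw [Finset.sum_range_succ, h7, hq, edgeDist_edgePt huv.ne]
        rcases le_total α c with g1 | g1 <;> rcases le_total c β with g2 | g2 <;>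
          rcases abs_cases (t - s) with g3 | g3 <;> rcases abs_cases (c - t) with g4 | g4 <;>
          rcases abs_cases (c - s) with g5 | g5 <;> simp only [min_eq_left, min_eq_right,
            max_eq_left, max_eq_right, g1, g2] <;> linarith
  obtain ⟨α, β, t, h1, h2, h3, h4, h5, h6, h7, h8, h9, h10⟩ := key T.len le_rfl
  refine ⟨u, v, α, β, huv, h1, h3.trans h4, h2, ?_, ?_⟩
  · rintro x (⟨i, hi, rfl⟩ | ⟨i, hi, hx⟩)
    · exact h8 i hi
    · exact h9 i hi x hx
  · have hnv := hv 0 (Nat.zero_le _)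
    rw [e, isVertex_edgePt_iff huv.ne hs] at hnv
    push Not at hnv
    have : t = s := by
      rw [← hT, e] at h7
      rcases (edgePt_eq_iff huv.ne huv.ne hs ⟨h1.trans h5, h6.trans h2⟩).1 h7 with
        ⟨-, -, h⟩ | ⟨h, -⟩ | ⟨x, (⟨-, h⟩ | ⟨-, h⟩), -⟩
      · exact h.symm
      · exact absurd h huv.ne
      · exact absurd h hnv.1
      · exact absurd h hnv.2
    rw [this, sub_self, abs_zero, add_zero] at h10
    exact h10

end

section
variable {V : Type*} {G : SimpleGraph V}

/-! ### Closed walks that use every edge at most twice -/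

theorem exists_eq_append_cons {u v : V} (W : G.Walk u v) {d : G.Dart} (hd : d ∈ W.darts) :
    ∃ (A : G.Walk u d.fst) (C : G.Walk d.snd v), W = A.append (.cons d.adj C) := by
  induction W with
  | nil => simp at hd
  | @cons u w v h W ih =>
    rw [SimpleGraph.Walk.darts_cons, List.mem_cons] at hd
    rcases hd with rfl | hd
    · exact ⟨.nil, W, rfl⟩
    · obtain ⟨A, C, rfl⟩ := ih hd
      exact ⟨.cons h A, C, rfl⟩

open Classical in
theorem exists_eq_append_of_two_le_count {u v : V} (W : G.Walk u v) {d : G.Dart}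
    (hd : 2 ≤ W.darts.count d) :
    ∃ (A : G.Walk u d.fst) (B : G.Walk d.snd d.fst) (C : G.Walk d.snd v),
      W = A.append (.cons d.adj (B.append (.cons d.adj C))) := by
  obtain ⟨A, C, rfl⟩ := exists_eq_append_cons W
    (List.count_pos_iff.1 (lt_of_lt_of_le zero_lt_two hd))
  rw [SimpleGraph.Walk.darts_append, SimpleGraph.Walk.darts_cons, List.count_append,
    List.count_cons_self] at hd
  by_cases h : d ∈ C.darts
  · obtain ⟨B, D, rfl⟩ := exists_eq_append_cons C h
    exact ⟨A, B, D, rfl⟩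
  · have h' : d ∈ A.darts := by
      rw [← List.count_pos_iff]
      have := List.count_eq_zero.2 h
      omega
    obtain ⟨B, D, rfl⟩ := exists_eq_append_cons A h'
    exact ⟨B, D, C, by rw [← SimpleGraph.Walk.append_assoc, SimpleGraph.Walk.cons_append]⟩

open Classical in
theorem count_edges_eq {u v : V} (W : G.Walk u v) (d : G.Dart) :
    W.edges.count d.edge = W.darts.count d + W.darts.count d.symm := by
  have hne : d ≠ d.symm := fun h => d.symm_ne h.symm
  induction W with
  | nil => simp
  | @cons u w v h W ih =>
    rw [SimpleGraph.Walk.edges_cons, SimpleGraph.Walk.darts_cons, List.count_cons,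
      List.count_cons, List.count_cons, ih]
    have : (s(u, w) = d.edge) ↔ (⟨(u, w), h⟩ : G.Dart) = d ∨ (⟨(u, w), h⟩ : G.Dart) = d.symm :=
      SimpleGraph.dart_edge_eq_iff ⟨(u, w), h⟩ d
    by_cases h1 : (⟨(u, w), h⟩ : G.Dart) = d
    · have h2 : ¬ (⟨(u, w), h⟩ : G.Dart) = d.symm := fun h2 => hne (h1.symm.trans h2)
      simp only [beq_iff_eq, this, h1, true_or, if_true]
      rw [if_neg hne]
      omega
    · by_cases h2 : (⟨(u, w), h⟩ : G.Dart) = d.symm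
      · simp only [beq_iff_eq, this, h2, or_true, if_true]
        rw [if_neg hne.symm]
        omega
      · simp only [beq_iff_eq, this, h1, h2, or_false, if_false]
        omega

open Classical in
/-- A walk can be shortened, keeping the sets of vertices and of edges, until every edge is used
at most twice. -/
theorem exists_walk_count_le_two {u v : V} (W : G.Walk u v) :
    ∃ W' : G.Walk u v, W'.length ≤ W.length ∧ (∀ x, x ∈ W'.support ↔ x ∈ W.support) ∧
      (∀ e, e ∈ W'.edges ↔ e ∈ W.edges) ∧ ∀ e, W'.edges.count e ≤ 2 := by
  induction h : W.length using Nat.strong_induction_on generalizing W with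
  | _ n ih =>
    by_cases hc : ∀ e, W.edges.count e ≤ 2
    · exact ⟨W, h.le, fun _ => Iff.rfl, fun _ => Iff.rfl, hc⟩
    push Not at hc
    obtain ⟨e, he⟩ := hc
    -- An edge used three times is used at least twice in one direction.
    obtain ⟨d, hd2, rfl⟩ : ∃ d : G.Dart, 2 ≤ W.darts.count d ∧ d.edge = e := by
      have : e ∈ W.edges := List.count_pos_iff.1 (by omega)
      obtain ⟨d, -, rfl⟩ := List.mem_map.1 this
      rw [count_edges_eq] at he
      rcases le_or_gt 2 (W.darts.count d) with h | h
      · exact ⟨d, h, rfl⟩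
      · exact ⟨d.symm, by omega, d.edge_symm⟩
    obtain ⟨A, B, C, rfl⟩ := exists_eq_append_of_two_le_count W hd2
    -- A third use survives the deletion of two, so the set of edges does not change.
    have hmem : d.edge ∈ A.edges ∨ d.edge ∈ B.edges ∨ d.edge ∈ C.edges := by
      by_contra! hcon
      have e1 : s(d.fst, d.snd) = d.edge := rfl
      simp only [SimpleGraph.Walk.edges_append, SimpleGraph.Walk.edges_cons, List.count_append, e1,
        List.count_cons_self, List.count_eq_zero.2 hcon.1, List.count_eq_zero.2 hcon.2.1,
        List.count_eq_zero.2 hcon.2.2] at he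
      omega
    -- Deleting both uses of `d` and reversing the part between them leaves a walk with the same
    -- ends.
    have hl : (A.append (B.reverse.append C)).length < n := by
      rw [← h]
      simp only [SimpleGraph.Walk.length_append, SimpleGraph.Walk.length_cons,
        SimpleGraph.Walk.length_reverse]
      omega
    obtain ⟨W', h1, h2, h3, h4⟩ := ih _ hl (A.append (B.reverse.append C)) rfl
    refine ⟨W', h1.trans hl.le, fun x => ?_, fun x => ?_, h4⟩
    · rw [h2]
      simp only [SimpleGraph.Walk.mem_support_append_iff, SimpleGraph.Walk.support_reverse,
        List.mem_reverse, SimpleGraph.Walk.support_cons, List.mem_cons]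
      have := A.end_mem_support
      constructor
      · tauto
      · rintro (h | rfl | h | rfl | h) <;> tauto
    · rw [h3]
      have e1 : s(d.fst, d.snd) = d.edge := rfl
      simp only [SimpleGraph.Walk.edges_append, SimpleGraph.Walk.edges_cons,
        SimpleGraph.Walk.edges_reverse, List.mem_append, List.mem_reverse, List.mem_cons, e1]
      constructor
      · tauto
      · rintro (h | rfl | h | rfl | h) <;> tauto

/-! ### Attaching stubs -/

/-- Adjacency in the graph `G` with a pendant vertex `e` at `e.1` for every `e ∈ P`. -/
def stubAdj (G : SimpleGraph V) (P : Finset (V × V)) : V ⊕ V × V → V ⊕ V × V → Prop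
  | .inl u, .inl v => G.Adj u v
  | .inl u, .inr e => e ∈ P ∧ e.1 = u
  | .inr e, .inl u => e ∈ P ∧ e.1 = u
  | .inr _, .inr _ => False

/-- The graph `G` with a pendant vertex `e` at `e.1` for every `e ∈ P`. -/
def stubGraph (G : SimpleGraph V) (P : Finset (V × V)) : SimpleGraph (V ⊕ V × V) where
  Adj := stubAdj G P
  symm := ⟨by
    rintro (u | e) (v | f) h
    · exact SimpleGraph.Adj.symm h
    · exact h
    · exact h
    · exact h⟩
  loopless := ⟨by
    rintro (u | e) h
    · exact G.loopless.irrefl u h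
    · exact h⟩

/-- The pairs of consecutive vertices of a walk. -/
def stepPairs {V : Type*} {G : SimpleGraph V} {u v : V} (W : G.Walk u v) : Multiset (V × V) :=
  ↑(W.darts.map (·.toProd))

theorem mem_stepPairs_iff {u v : V} (W : G.Walk u v) (p : V × V) :
    p ∈ stepPairs W ↔ ∃ i < W.length, p = (W.getVert i, W.getVert (i + 1)) := by
  rw [stepPairs, Multiset.mem_coe, List.mem_iff_getElem]
  constructor
  · rintro ⟨i, hi, rfl⟩
    rw [List.length_map, SimpleGraph.Walk.length_darts] at hi
    exact ⟨i, hi, by simp [SimpleGraph.Walk.darts_getElem_eq_getVert]⟩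
  · rintro ⟨i, hi, rfl⟩
    exact ⟨i, by simpa using hi, by simp [SimpleGraph.Walk.darts_getElem_eq_getVert]⟩

/-- Lengths and numbers of traversals are sums over steps, and the multiset of steps, unlike their
order, has a simple form after detours are inserted. -/
theorem sum_stepPairs {u v : V} (W : G.Walk u v) {M : Type*} [AddCommMonoid M] (f : V × V → M) :
    ∑ i ∈ Finset.range W.length, f (W.getVert i, W.getVert (i + 1)) =
      ((stepPairs W).map f).sum := by
  induction W with
  | nil => simp [stepPairs]
  | cons h W ih =>
    rw [SimpleGraph.Walk.length_cons, Finset.sum_range_succ']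
    simp only [SimpleGraph.Walk.getVert_cons_succ, SimpleGraph.Walk.getVert_zero, ih]
    simp [stepPairs, add_comm]

theorem sum_map_finsetSum {ι α M : Type*} [AddCommMonoid M] (f : α → M) (P : Finset ι)
    (g : ι → Multiset α) : ((∑ e ∈ P, g e).map f).sum = ∑ e ∈ P, ((g e).map f).sum := by
  classical
  induction P using Finset.induction_on with
  | empty => simp
  | insert e S he ih =>
    rw [Finset.sum_insert he, Finset.sum_insert he, Multiset.map_add, Multiset.sum_add, ih]

theorem exists_stubGraph_walk_of_walk {u v : V} (W : G.Walk u v) (P : Finset (V × V)) :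
    ∃ W' : (stubGraph G P).Walk (.inl u) (.inl v), (∀ x ∈ W.support, Sum.inl x ∈ W'.support) ∧
      stepPairs W' = (stepPairs W).map (Prod.map Sum.inl Sum.inl) := by
  induction W with
  | nil => exact ⟨.nil, by simp, by simp [stepPairs]⟩
  | @cons u w v h W ih =>
    obtain ⟨W', h1, h2⟩ := ih
    have h' : (stubGraph G P).Adj (.inl u) (.inl w) := h
    refine ⟨.cons h' W', fun x hx => ?_, ?_⟩
    · rw [SimpleGraph.Walk.support_cons, List.mem_cons] at hx ⊢
      exact hx.imp (congrArg _) (h1 x)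
    · simp only [stepPairs, SimpleGraph.Walk.darts_cons, List.map_cons, ← Multiset.cons_coe,
        Multiset.map_cons] at h2 ⊢
      rw [h2]
      rfl

open Classical in
/-- Insert a detour to every pendant vertex into a closed walk. -/
theorem exists_stubGraph_walk {o : V} (W : G.Walk o o) (P : Finset (V × V))
    (hP : ∀ e ∈ P, e.1 ∈ W.support) :
    ∃ W' : (stubGraph G P).Walk (.inl o) (.inl o),
      (∀ x ∈ W.support, Sum.inl x ∈ W'.support) ∧
      stepPairs W' = (stepPairs W).map (Prod.map Sum.inl Sum.inl) +
        ∑ e ∈ P, {(Sum.inl e.1, Sum.inr e), (Sum.inr e, Sum.inl e.1)} := by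
  suffices ∀ S ⊆ P, ∃ W' : (stubGraph G P).Walk (.inl o) (.inl o),
      (∀ x ∈ W.support, Sum.inl x ∈ W'.support) ∧
      stepPairs W' = (stepPairs W).map (Prod.map Sum.inl Sum.inl) +
        ∑ e ∈ S, {(Sum.inl e.1, Sum.inr e), (Sum.inr e, Sum.inl e.1)} from this P subset_rfl
  intro S
  induction S using Finset.induction_on with
  | empty =>
    intro _
    simpa using exists_stubGraph_walk_of_walk W P
  | insert e S he ih =>
    intro hS
    obtain ⟨W', h1, h2⟩ := ih fun x hx => hS (Finset.mem_insert_of_mem hx)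
    have heP : e ∈ P := hS (Finset.mem_insert_self _ _)
    obtain ⟨A, C, rfl⟩ := SimpleGraph.Walk.mem_support_iff_exists_append.1 (h1 _ (hP e heP))
    have hadj : (stubGraph G P).Adj (.inl e.1) (.inr e) := ⟨heP, rfl⟩
    refine ⟨A.append (.cons hadj (.cons hadj.symm C)), fun x hx => ?_, ?_⟩
    · have := h1 x hx
      rw [SimpleGraph.Walk.mem_support_append_iff] at this ⊢
      simp only [SimpleGraph.Walk.support_cons, List.mem_cons]
      tauto
    · rw [Finset.sum_insert he, add_left_comm, ← h2]
      simp only [stepPairs, SimpleGraph.Walk.darts_append, SimpleGraph.Walk.darts_cons,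
        List.map_append, List.map_cons, ← Multiset.coe_add, ← Multiset.cons_coe]
      rw [Multiset.add_cons, Multiset.add_cons, Multiset.insert_eq_cons, Multiset.cons_add,
        Multiset.singleton_add]

/-- The position of a vertex of `stubGraph`: the stub `e` has length `t e`. -/
def stubPt (t : V × V → ℝ) : V ⊕ V × V → V → ℝ
  | .inl v => vertexPt v
  | .inr e => edgePt e.1 e.2 (t e)

/-- The edge of `G` that contains an edge of `stubGraph`. -/
def stubEdge : (V ⊕ V × V) × (V ⊕ V × V) → Sym2 V
  | (.inl u, .inl v) => s(u, v)
  | (.inl _, .inr e) => s(e.1, e.2)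
  | (.inr e, _) => s(e.1, e.2)

theorem vertexPt_injective : Function.Injective (vertexPt : V → V → ℝ) := by
  intro u v h
  have := congrFun h u
  simp only [vertexPt, if_true] at this
  by_contra hne
  simp [hne] at this

/-- A family of stubs of edges that are not used by the closed walk `W`. -/
structure IsStubFamily {o : V} (W : G.Walk o o) (P : Finset (V × V)) (t : V × V → ℝ) : Prop where
  adj : ∀ e ∈ P, G.Adj e.1 e.2
  notMem_edges : ∀ e ∈ P, s(e.1, e.2) ∉ W.edges
  mem_support : ∀ e ∈ P, e.1 ∈ W.support
  eq_of_edge : ∀ e ∈ P, ∀ f ∈ P, s(e.1, e.2) = s(f.1, f.2) → e = f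
  pos : ∀ e ∈ P, 0 < t e
  le_one : ∀ e ∈ P, t e ≤ 1

section
variable {o : V} {W : G.Walk o o} {P : Finset (V × V)} {t : V × V → ℝ}

theorem IsStubFamily.exists_segment (S : IsStubFamily W P t) {p q : V ⊕ V × V}
    (h : (stubGraph G P).Adj p q) :
    ∃ (u v : V) (a b : ℝ), G.Adj u v ∧ a ∈ Set.Icc (0 : ℝ) 1 ∧ b ∈ Set.Icc (0 : ℝ) 1 ∧ a ≠ b ∧
      stubPt t p = edgePt u v a ∧ stubPt t q = edgePt u v b := by
  rcases p with u | e <;> rcases q with v | f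
  · exact ⟨u, v, 0, 1, h, by simp, by simp, zero_ne_one, (edgePt_zero _ _).symm,
      (edgePt_one _ _).symm⟩
  · obtain ⟨hf, rfl⟩ := h
    exact ⟨f.1, f.2, 0, t f, S.adj f hf, by simp, ⟨(S.pos f hf).le, S.le_one f hf⟩,
      (S.pos f hf).ne, (edgePt_zero _ _).symm, rfl⟩
  · obtain ⟨hf, rfl⟩ := h
    exact ⟨e.1, e.2, t e, 0, S.adj e hf, ⟨(S.pos e hf).le, S.le_one e hf⟩, by simp,
      (S.pos e hf).ne', rfl, (edgePt_zero _ _).symm⟩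
  · exact h.elim

/-- The tour that follows a walk in the graph with stubs. -/
def IsStubFamily.tour (S : IsStubFamily W P t)
    (W' : (stubGraph G P).Walk (.inl o) (.inl o)) (ho : ∃ x, G.Adj o x) : Walk G where
  len := W'.length
  pt i := stubPt t (W'.getVert i)
  mem_points i hi := by
    rcases hi.lt_or_eq with h | rfl
    · obtain ⟨u, v, a, b, h1, h2, -, -, h3, -⟩ := S.exists_segment (W'.adj_getVert_succ h)
      rw [h3]
      exact edgePt_mem_points h1 h2
    · obtain ⟨x, hx⟩ := ho
      rw [SimpleGraph.Walk.getVert_length, stubPt, ← edgePt_zero o x]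
      exact edgePt_mem_points hx (by simp)
  step i hi := S.exists_segment (W'.adj_getVert_succ hi)

/-- The tip of a stub is a vertex only for a stub of length `1`, and then that vertex is the other
end of its edge. -/
theorem IsStubFamily.stubEdge_eq (S : IsStubFamily W P t) {p q : V ⊕ V × V}
    (h : (stubGraph G P).Adj p q) {u v : V} (hp : stubPt t p = vertexPt u)
    (hq : stubPt t q = vertexPt v) :
    stubEdge (p, q) = s(u, v) ∧ ∀ e, p = .inr e ∨ q = .inr e → t e = 1 := by
  have key : ∀ e ∈ P, ∀ w, edgePt e.1 e.2 (t e) = vertexPt w → t e = 1 ∧ e.2 = w := by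
    intro e he w hw
    have h0 := S.pos e he
    have hI : t e ∈ Set.Icc (0 : ℝ) 1 := ⟨h0.le, S.le_one e he⟩
    have h1 : t e = 1 :=
      ((isVertex_edgePt_iff (S.adj e he).ne hI).1 ⟨w, hw⟩).resolve_left h0.ne'
    rw [h1, edgePt_one] at hw
    exact ⟨h1, vertexPt_injective hw⟩
  rcases p with x | e <;> rcases q with y | f
  · rw [vertexPt_injective hp, vertexPt_injective hq]
    exact ⟨rfl, by simp⟩
  · obtain ⟨hf, rfl⟩ := h
    obtain ⟨h1, h2⟩ := key f hf v hq
    rw [← h2, ← vertexPt_injective hp]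
    exact ⟨rfl, by rintro e (h | h) <;> simp at h; rwa [← h]⟩
  · obtain ⟨hf, rfl⟩ := h
    obtain ⟨h1, h2⟩ := key e hf u hp
    rw [← h2, ← vertexPt_injective hq]
    exact ⟨Sym2.eq_swap, by rintro e (h | h) <;> simp at h; rwa [← h]⟩
  · exact h.elim

/-- Stops inside edges are tips of stubs shorter than `1`, and the tip identifies the edge. -/
theorem IsStubFamily.mem_openEdge (S : IsStubFamily W P t) {p : V ⊕ V × V} {u v : V}
    (hp : ∀ e, p = .inr e → e ∈ P) (huv : G.Adj u v) (h : stubPt t p ∈ openEdge u v) :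
    ∃ e ∈ P, p = .inr e ∧ s(e.1, e.2) = s(u, v) ∧ t e < 1 := by
  obtain ⟨a, ⟨ha0, ha1⟩, h⟩ := h
  have haI : a ∈ Set.Icc (0 : ℝ) 1 := ⟨ha0.le, ha1.le⟩
  rcases p with x | e
  · have := (isVertex_edgePt_iff huv.ne haI).1 ⟨x, h.symm⟩
    rcases this with h | h <;> linarith
  · have he := hp e rfl
    refine ⟨e, he, rfl, ?_⟩
    have := (edgePt_eq_iff (S.adj e he).ne huv.ne ⟨(S.pos e he).le, S.le_one e he⟩ haI).1 h
    rcases this with ⟨h1, h2, h3⟩ | ⟨h1, h2, h3⟩ | ⟨x, -, (⟨-, h3⟩ | ⟨-, h3⟩)⟩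
    · rw [h1, h2]; exact ⟨rfl, by linarith⟩
    · rw [h1, h2]; exact ⟨Sym2.eq_swap, by linarith⟩
    · linarith
    · linarith

open Classical in
theorem IsStubFamily.isNice (S : IsStubFamily W P t) (hW : ∀ e, W.edges.count e ≤ 2)
    {W' : (stubGraph G P).Walk (.inl o) (.inl o)}
    (hW' : stepPairs W' = (stepPairs W).map (Prod.map Sum.inl Sum.inl) +
        ∑ e ∈ P, {(Sum.inl e.1, Sum.inr e), (Sum.inr e, Sum.inl e.1)})
    (ho : ∃ x, G.Adj o x) (h3 : 3 ≤ W'.length) : (S.tour W' ho).IsNice := by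
  have hlen : (S.tour W' ho).len = W'.length := rfl
  have hpt : ∀ i, (S.tour W' ho).pt i = stubPt t (W'.getVert i) := fun _ => rfl
  have hinr : ∀ i e, W'.getVert i = .inr e → e ∈ P := by
    intro i e he
    rcases lt_or_ge i W'.length with h | h
    · have := W'.adj_getVert_succ h
      rw [he] at this
      cases hv : W'.getVert (i + 1) with
      | inl x => rw [hv] at this; exact this.1
      | inr x => rw [hv] at this; exact this.elim
    · rw [W'.getVert_of_length_le h] at he
      cases he
  have htour : (S.tour W' ho).IsTour := by
    rw [Walk.IsTour, hpt, hpt, hlen, SimpleGraph.Walk.getVert_zero,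
      SimpleGraph.Walk.getVert_length]
  have htrav : ∀ u v i, i < W'.length → (S.tour W' ho).TraversesAt u v i →
      stubEdge (W'.getVert i, W'.getVert (i + 1)) = s(u, v) ∧
      ∀ e, W'.getVert i = .inr e ∨ W'.getVert (i + 1) = .inr e → t e = 1 := by
    rintro u v i hi (⟨h1, h2⟩ | ⟨h1, h2⟩)
    · exact S.stubEdge_eq (W'.adj_getVert_succ hi) h1 h2
    · rw [Sym2.eq_swap]
      exact S.stubEdge_eq (W'.adj_getVert_succ hi) h1 h2
  refine ⟨htour, h3, fun i hi => ?_, fun i hi hv => ?_, fun u v huv i hi j hj h1 h2 => ?_,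
    fun u v huv ⟨i, hi, h⟩ j hj hjo => ?_, fun u v huv => ?_⟩
  · have := W'.adj_getVert_succ hi
    rw [hpt, hpt]
    cases h1 : W'.getVert i with
    | inl x => exact Or.inl ⟨x, rfl⟩
    | inr e =>
      cases h2 : W'.getVert (i + 1) with
      | inl x => exact Or.inr ⟨x, rfl⟩
      | inr f => rw [h1, h2] at this; exact this.elim
  · rw [hpt] at hv
    rw [hlen] at hi
    -- The last stop is the vertex `o`, so a stop inside an edge is not the last; the residue modulo
    -- the length matters only when the next stop is the last one.
    have hi2 : i + 2 ≤ W'.length := by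
      by_contra h
      have : i + 1 = W'.length := by omega
      rw [this, SimpleGraph.Walk.getVert_length] at hv
      exact hv ⟨o, rfl⟩
    have hmod : (S.tour W' ho).pt ((i + 2) % (S.tour W' ho).len) = (S.tour W' ho).pt (i + 2) := by
      rw [hlen]
      rcases hi2.lt_or_eq with h | h
      · rw [Nat.mod_eq_of_lt h]
      · rw [h, Nat.mod_self]; exact htour
    rw [hmod, hpt, hpt]
    have a1 := W'.adj_getVert_succ hi
    have a2 := W'.adj_getVert_succ (show i + 1 < W'.length by omega)
    rw [show i + 1 + 1 = i + 2 from rfl] at a2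
    cases h1 : W'.getVert (i + 1) with
    | inl x => rw [h1] at hv; exact absurd ⟨x, rfl⟩ hv
    | inr e =>
      rw [h1] at a1 a2
      cases h0 : W'.getVert i with
      | inl x =>
        cases h2 : W'.getVert (i + 2) with
        | inl y =>
          rw [h0] at a1
          rw [h2] at a2
          rw [← a1.2, ← a2.2]
        | inr f => rw [h2] at a2; exact a2.elim
      | inr f => rw [h0] at a1; exact a1.elim
  · rw [hpt] at h1 h2
    obtain ⟨e, he, hei, hes, -⟩ := S.mem_openEdge (hinr i) huv h1
    obtain ⟨f, hf, hfj, hfs, -⟩ := S.mem_openEdge (hinr j) huv h2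
    obtain rfl := S.eq_of_edge e he f hf (hes.trans hfs.symm)
    have hsum := sum_stepPairs W' (fun p => if p.2 = .inr e then 1 else 0)
    rw [hW'] at hsum
    have hval : (Multiset.map (fun p : (V ⊕ V × V) × (V ⊕ V × V) => if p.2 = .inr e then 1 else 0)
        ((stepPairs W).map (Prod.map Sum.inl Sum.inl) +
        ∑ e ∈ P, {(Sum.inl e.1, Sum.inr e), (Sum.inr e, Sum.inl e.1)})).sum ≤ 1 := by
      rw [Multiset.map_add, Multiset.sum_add, Multiset.map_map,
        sum_map_finsetSum]
      simp
      split_ifs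
      all_goals simp
    rw [← hsum, ← Finset.card_filter] at hval
    have := Finset.card_le_one.1 hval (i - 1)
      (Finset.mem_filter.2 ⟨Finset.mem_range.2 (by have := hi.1; have := hi.2; omega), by
        rw [Nat.sub_add_cancel hi.1]; exact hei⟩) (j - 1)
      (Finset.mem_filter.2 ⟨Finset.mem_range.2 (by have := hj.1; have := hj.2; omega), by
        rw [Nat.sub_add_cancel hj.1]; exact hfj⟩)
    have := hi.1
    have := hj.1
    omega
  · rw [hpt] at hjo
    obtain ⟨e, he, hej, hes, het⟩ := S.mem_openEdge (hinr j) huv hjo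
    obtain ⟨h4, h5⟩ := htrav u v i hi h
    have hmem : (W'.getVert i, W'.getVert (i + 1)) ∈ stepPairs W' :=
      (mem_stepPairs_iff W' _).2 ⟨i, hi, rfl⟩
    rw [hW', Multiset.mem_add, Multiset.mem_map, Multiset.mem_sum] at hmem
    rcases hmem with ⟨⟨x, y⟩, hxy, h6⟩ | ⟨f, hf, h6⟩
    · rw [← h6] at h4
      change s(x, y) = _ at h4
      rw [stepPairs, Multiset.mem_coe, List.mem_map] at hxy
      obtain ⟨d, hd, hdxy⟩ := hxy
      refine S.notMem_edges e he ?_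
      rw [hes, ← h4]
      refine List.mem_map.2 ⟨d, hd, ?_⟩
      rw [SimpleGraph.Dart.edge, hdxy]
    · have hef : s(f.1, f.2) = s(u, v) ∧ t f = 1 := by
        simp only [Multiset.insert_eq_cons, Multiset.mem_cons, Multiset.mem_singleton,
          Prod.mk.injEq] at h6
        rcases h6 with ⟨h6, h7⟩ | ⟨h6, h7⟩
        · rw [h6, h7] at h4; exact ⟨h4, h5 f (Or.inr h7)⟩
        · rw [h6, h7] at h4; exact ⟨h4, h5 f (Or.inl h6)⟩
      obtain rfl := S.eq_of_edge e he f hf (hes.trans hef.1.symm)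
      linarith [hef.2]
  · have hsum := sum_stepPairs W' (fun p => if stubEdge p = s(u, v) then 1 else 0)
    rw [← Finset.card_filter, hW', Multiset.map_add, Multiset.sum_add, Multiset.map_map,
      sum_map_finsetSum] at hsum
    have hcount : (Multiset.map ((fun p => if stubEdge p = s(u, v) then 1 else 0) ∘
        Prod.map Sum.inl Sum.inl) (stepPairs W)).sum = W.edges.count s(u, v) := by
      rw [stepPairs, Multiset.map_coe, Multiset.sum_coe, List.map_map,
        SimpleGraph.Walk.edges]
      generalize W.darts = l
      induction l with
      | nil => simp
      | cons d l ih =>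
        rw [List.map_cons, List.map_cons, List.sum_cons, ih, List.count_cons, add_comm]
        have : stubEdge (Prod.map Sum.inl Sum.inl d.toProd) = d.edge := rfl
        simp [this]
    rw [hcount] at hsum
    have hsub : {i | i < (S.tour W' ho).len ∧ (S.tour W' ho).TraversesAt u v i} ⊆
        ↑({i ∈ Finset.range W'.length |
          stubEdge (W'.getVert i, W'.getVert (i + 1)) = s(u, v)} : Finset ℕ) := by
      rintro i ⟨hi, h⟩
      exact Finset.mem_coe.2 (Finset.mem_filter.2 ⟨Finset.mem_range.2 hi, (htrav u v i hi h).1⟩)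
    refine (Set.ncard_le_ncard hsub (Finset.finite_toSet _)).trans ?_
    rw [Set.ncard_coe_finset, hsum]
    have hP : ∑ e ∈ P, (Multiset.map (fun p => if stubEdge p = s(u, v) then 1 else 0)
        ({(Sum.inl e.1, Sum.inr e), (Sum.inr e, Sum.inl e.1)} : Multiset _)).sum =
        ∑ e ∈ P, if s(e.1, e.2) = s(u, v) then 2 else 0 := by
      refine Finset.sum_congr rfl fun e _ => ?_
      have h1 : stubEdge (Sum.inl e.1, Sum.inr e) = s(e.1, e.2) := rfl
      have h2 : stubEdge (Sum.inr e, Sum.inl e.1) = s(e.1, e.2) := rfl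
      by_cases h : s(e.1, e.2) = s(u, v)
      · simp only [Multiset.insert_eq_cons, Multiset.map_cons, Multiset.map_singleton, h1, h2, h,
          if_true, Multiset.sum_cons, Multiset.sum_singleton]
      · simp only [Multiset.insert_eq_cons, Multiset.map_cons, Multiset.map_singleton, h1, h2, h,
          if_false, Multiset.sum_cons, Multiset.sum_singleton]
    rw [hP]
    by_cases hex : ∃ f ∈ P, s(f.1, f.2) = s(u, v)
    · obtain ⟨f, hf, hfe⟩ := hex
      have h0 : W.edges.count s(u, v) = 0 := by
        rw [List.count_eq_zero, ← hfe]; exact S.notMem_edges f hf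
      rw [h0, zero_add, Finset.sum_eq_single_of_mem f hf, if_pos hfe]
      intro e he hne
      exact if_neg fun h => hne (S.eq_of_edge e he f hf (h.trans hfe.symm))
    · push Not at hex
      rw [Finset.sum_eq_zero fun e he => if_neg (hex e he), add_zero]
      exact hW _

theorem Walk.stops_ncard_le_two {T : Walk G} (hT : T.IsTour) (h : T.len < 3) :
    T.stops.ncard ≤ 2 := by
  have hsub : T.stops ⊆ {T.pt 0, T.pt 1} := by
    rintro p ⟨i, hi, rfl⟩
    rw [Walk.IsTour] at hT
    obtain rfl | rfl | rfl : i = 0 ∨ i = 1 ∨ i = 2 := by omega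
    · exact Or.inl rfl
    · exact Or.inr rfl
    · have : T.len = 2 := by omega
      rw [this] at hT
      exact Or.inl hT.symm
  exact (Set.ncard_le_ncard hsub (Set.toFinite _)).trans (Set.ncard_insert_le _ _ |>.trans (by simp))

/-- The tour follows `W` with one detour to every tip. Niceness can fail only for fewer than three
steps, and then there are at most two stops. -/
theorem IsStubFamily.exists_tour [Fintype V] (S : IsStubFamily W P t)
    (hW : ∀ e, (open Classical in W.edges.count e) ≤ 2) (ho : ∃ x, G.Adj o x) :
    ∃ T : Walk G, T.IsTour ∧ (T.IsNice ∨ T.stops.ncard ≤ 2) ∧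
      (∀ p ∈ T.stops, (∃ v, p = vertexPt v) ∨ ∃ e ∈ P, p = edgePt e.1 e.2 (t e)) ∧
      T.length = W.length + 2 * ∑ e ∈ P, t e ∧
      (∀ v ∈ W.support, vertexPt v ∈ T.passed) ∧
      (∀ u v, ∀ c ∈ Set.Icc (0 : ℝ) 1, s(u, v) ∈ W.edges → edgePt u v c ∈ T.passed) ∧
      (∀ e ∈ P, ∀ c ∈ Set.Icc (0 : ℝ) (t e), edgePt e.1 e.2 c ∈ T.passed) := by
  classical
  obtain ⟨W', h1, h2⟩ := exists_stubGraph_walk W P S.mem_support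
  have hlen : (S.tour W' ho).len = W'.length := rfl
  have hpt : ∀ i, (S.tour W' ho).pt i = stubPt t (W'.getVert i) := fun _ => rfl
  have htour : (S.tour W' ho).IsTour := by
    rw [Walk.IsTour, hpt, hpt, hlen, SimpleGraph.Walk.getVert_zero,
      SimpleGraph.Walk.getVert_length]
  have hpassed : ∀ p q, (p, q) ∈ stepPairs W' → ∀ x ∈ edgeSegment G (stubPt t p) (stubPt t q),
      x ∈ (S.tour W' ho).passed := by
    intro p q hpq x hx
    obtain ⟨i, hi, h⟩ := (mem_stepPairs_iff W' _).1 hpq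
    rw [Prod.mk.injEq] at h
    rw [h.1, h.2] at hx
    exact Or.inr ⟨i, hi, hx⟩
  refine ⟨S.tour W' ho, htour, ?_, ?_, ?_, ?_, ?_, ?_⟩
  · rcases le_or_gt 3 W'.length with h | h
    · exact Or.inl (S.isNice (fun e => by convert hW e) h2 ho h)
    · exact Or.inr (Walk.stops_ncard_le_two htour h)
  · rintro p ⟨i, hi, rfl⟩
    rw [hpt]
    cases h : W'.getVert i with
    | inl x => exact Or.inl ⟨x, rfl⟩
    | inr e =>
      refine Or.inr ⟨e, ?_, rfl⟩
      have hi' : i < W'.length := by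
        refine lt_of_le_of_ne hi fun hne => ?_
        rw [hne.trans hlen, SimpleGraph.Walk.getVert_length] at h
        cases h
      have := W'.adj_getVert_succ hi'
      rw [h] at this
      cases hv : W'.getVert (i + 1) with
      | inl x => rw [hv] at this; exact this.1
      | inr x => rw [hv] at this; exact this.elim
  · have hsum := sum_stepPairs W' (fun p => edgeDist (stubPt t p.1) (stubPt t p.2))
    rw [h2, Multiset.map_add, Multiset.sum_add, Multiset.map_map,
      sum_map_finsetSum] at hsum
    refine hsum.trans ?_
    congr 1
    · rw [stepPairs, Multiset.map_coe, Multiset.sum_coe, List.map_map, ← W.length_darts]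
      generalize W.darts = l
      induction l with
      | nil => simp
      | cons d l ih =>
        rw [List.map_cons, List.sum_cons, ih, List.length_cons]
        have : edgeDist (vertexPt d.fst) (vertexPt d.snd) = 1 := by
          rw [← edgePt_zero d.fst d.snd, ← edgePt_one d.fst d.snd, edgeDist_edgePt d.adj.ne]
          simp
        change edgeDist (vertexPt d.fst) (vertexPt d.snd) + _ = _
        rw [this]; push_cast; ring
    · rw [Finset.mul_sum]
      refine Finset.sum_congr rfl fun e he => ?_
      simp only [Multiset.insert_eq_cons, Multiset.map_cons, Multiset.map_singleton, stubPt,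
        Multiset.sum_cons, Multiset.sum_singleton]
      rw [← edgePt_zero e.1 e.2, edgeDist_edgePt (S.adj e he).ne,
        edgeDist_edgePt (S.adj e he).ne, sub_zero, zero_sub, abs_neg, abs_of_pos (S.pos e he)]
      ring
  · intro v hv
    obtain ⟨i, h, hi⟩ := SimpleGraph.Walk.mem_support_iff_exists_getVert.1 (h1 v hv)
    exact Or.inl ⟨i, hi, by rw [hpt, h]; rfl⟩
  · suffices ∀ d ∈ W.darts, ∀ c ∈ Set.Icc (0 : ℝ) 1,
        edgePt d.fst d.snd c ∈ (S.tour W' ho).passed by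
      intro u v c hc huv
      obtain ⟨d, hd, he⟩ := List.mem_map.1 huv
      rcases SimpleGraph.dart_edge_eq_mk'_iff'.1 he with ⟨rfl, rfl⟩ | ⟨rfl, rfl⟩
      · exact this d hd c hc
      · rw [edgePt_swap]
        exact this d hd _ (one_sub_mem_Icc hc)
    intro d hd c hc
    refine hpassed (.inl d.fst) (.inl d.snd) ?_ _ ⟨d.fst, d.snd, 0, 1, c, d.adj, by simp,
      by simp, (edgePt_zero _ _).symm, (edgePt_one _ _).symm, by simpa using hc.1,
      by simpa using hc.2, rfl⟩
    rw [h2, Multiset.mem_add]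
    left
    exact Multiset.mem_map.2 ⟨d.toProd, Multiset.mem_coe.2 (List.mem_map.2 ⟨d, hd, rfl⟩), rfl⟩
  · intro e he c hc
    refine hpassed (.inl e.1) (.inr e) ?_ _ ⟨e.1, e.2, 0, t e, c, S.adj e he, by simp,
      ⟨(S.pos e he).le, S.le_one e he⟩, (edgePt_zero _ _).symm, rfl, ?_, ?_, rfl⟩
    · rw [h2, Multiset.mem_add]
      right
      exact Multiset.mem_sum.2 ⟨e, he, by simp⟩
    · exact (min_le_left _ _).trans hc.1
    · exact hc.2.trans (le_max_right _ _)

end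

end

/-! ### Discretized tours and their lengths -/

section
variable {V : Type*} [Fintype V] {G : SimpleGraph V}

/-- The `δ`-tours that are nice or have at most two stops, with all stops at positions in
`positions δ`. -/
structure IsDiscretized (G : SimpleGraph V) (δ : ℝ) (T : Walk G) : Prop where
  isDeltaTour : IsDeltaTour G δ T
  isNice_or : T.IsNice ∨ T.stops.ncard ≤ 2
  positions : ∀ p ∈ T.stops, ∃ (u v : V) (a : ℝ), G.Adj u v ∧ a ∈ positions δ ∧ p = edgePt u v a

/-- The possible lengths of discretized tours. -/
def tourLengths (V : Type*) [Fintype V] (δ : ℝ) : Set ℝ :=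
  {L | ∃ n ≤ 2 * Fintype.card (Sym2 V), ∃ y : V × V → ℝ,
    (∀ e, y e ∈ insert 1 (positions δ)) ∧ L = n + 2 * ∑ e, (1 - y e)} ∪
  {L | ∃ x ∈ insert 1 (positions δ), ∃ y ∈ insert 1 (positions δ), L = 2 * (1 - x - y)}

theorem tourLengths_finite (V : Type*) [Fintype V] (δ : ℝ) : (tourLengths V δ).Finite := by
  have hF : (insert 1 (positions δ)).Finite := (positions_finite δ).insert 1
  refine Set.Finite.union ?_ ?_
  · have h1 : (Set.univ.pi fun _ : V × V => insert 1 (positions δ)).Finite :=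
      Set.Finite.pi fun _ => hF
    refine (((Set.finite_Iic (2 * Fintype.card (Sym2 V))).prod h1).image
      fun p : ℕ × (V × V → ℝ) => (p.1 : ℝ) + 2 * ∑ e, (1 - p.2 e)).subset ?_
    rintro L ⟨n, hn, y, hy, rfl⟩
    exact ⟨(n, y), ⟨hn, fun e _ => hy e⟩, rfl⟩
  · refine ((hF.prod hF).image fun p : ℝ × ℝ => 2 * (1 - p.1 - p.2)).subset ?_
    rintro L ⟨x, hx, y, hy, rfl⟩
    exact ⟨(x, y), ⟨hx, hy⟩, rfl⟩

/-- Position `1` is position `0` on the reversed edge. -/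
theorem exists_position {V : Type*} {G : SimpleGraph V} {δ : ℝ} {u v : V} (h : G.Adj u v) {a : ℝ}
    (ha : a ∈ insert 1 (positions δ)) :
    ∃ (u' v' : V) (b : ℝ), G.Adj u' v' ∧ b ∈ positions δ ∧ edgePt u v a = edgePt u' v' b := by
  rcases ha with rfl | ha
  · exact ⟨v, u, 0, h.symm, Or.inl rfl, by rw [edgePt_one, edgePt_zero]⟩
  · exact ⟨u, v, a, h, ha, rfl⟩

/-! ### Tours that stop at a vertex -/

open Classical in
/-- The edges that are not used by the walk `W` but start at one of its vertices, each in one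
orientation. -/
def stubPairs {o : V} (W : G.Walk o o) : Finset (V × V) :=
  {e | G.Adj e.1 e.2 ∧ s(e.1, e.2) ∉ W.edges ∧ e.1 ∈ W.support ∧
    (e.2 ∈ W.support → Fintype.equivFin V e.1 < Fintype.equivFin V e.2)}

/-- The vertex `v` is reached by an edge that leaves the walk at `u`. -/
def leaves {o : V} (W : G.Walk o o) (u v : V) : Prop :=
  G.Adj u v ∧ u ∈ W.support ∧ v ∉ W.support

section
variable {o : V} {W : G.Walk o o}

theorem mem_stubPairs {e : V × V} : e ∈ stubPairs W ↔
    G.Adj e.1 e.2 ∧ s(e.1, e.2) ∉ W.edges ∧ e.1 ∈ W.support ∧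
      (e.2 ∈ W.support → Fintype.equivFin V e.1 < Fintype.equivFin V e.2) := by
  simp [stubPairs]

theorem swap_notMem_stubPairs {e : V × V} (h : e ∈ stubPairs W) : e.swap ∉ stubPairs W := by
  intro h'
  rw [mem_stubPairs] at h h'
  exact lt_asymm (h.2.2.2 h'.2.2.1) (h'.2.2.2 h.2.2.1)

theorem leaves.mem_stubPairs {u v : V} (h : leaves W u v) : (u, v) ∈ stubPairs W :=
  ContinuousGraph.mem_stubPairs.2 ⟨h.1,
    fun he => h.2.2 (W.snd_mem_support_of_mem_edges he), h.2.1, fun hv => absurd hv h.2.2⟩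

theorem eq_of_mem_stubPairs {e f : V × V} (he : e ∈ stubPairs W) (hf : f ∈ stubPairs W)
    (h : s(e.1, e.2) = s(f.1, f.2)) : e = f := by
  rcases Sym2.eq_iff.1 h with ⟨h1, h2⟩ | ⟨h1, h2⟩
  · exact Prod.ext h1 h2
  · have : e = f.swap := Prod.ext h1 h2
    rw [this] at he
    exact absurd he (swap_notMem_stubPairs hf)

/-- `stubPairs W` contains each edge in at most one orientation, so no value of `f` is counted
twice. -/
theorem sum_add_swap_le (f : V × V → ℝ) (hf : ∀ e, 0 ≤ f e) :
    ∑ e ∈ stubPairs W, (f e + f e.swap) ≤ ∑ x, ∑ y, f (x, y) := by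
  classical
  have hswap : ∑ e ∈ stubPairs W, f e.swap =
      ∑ e ∈ (stubPairs W).image Prod.swap, f e :=
    (Finset.sum_image fun a _ b _ h => Prod.swap_injective h).symm
  rw [Finset.sum_add_distrib, hswap, ← Finset.sum_union, ← Fintype.sum_prod_type']
  · exact Finset.sum_le_sum_of_subset_of_nonneg (Finset.subset_univ _) fun e _ _ => hf e
  · rw [Finset.disjoint_left]
    intro e he he'
    obtain ⟨f, hf, rfl⟩ := Finset.mem_image.1 he'
    exact swap_notMem_stubPairs hf he

theorem isGapData_of_walk (hG : G.Connected) {y : V × V → ℝ}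
    (hy : ∀ e ∈ stubPairs W, 0 ≤ y e ∧ y e ≤ 1) :
    IsGapData G (· ∈ W.support) (leaves W) (fun u v => y (u, v)) where
  adj _ _ h := h.1
  not_visited _ _ h := h.2.2
  boundary _ _ h hu hv := ⟨h, hu, hv⟩
  back _ _ h := Or.inl h.2.1
  nonempty v hv := by
    obtain ⟨p⟩ := hG o v
    obtain ⟨d, -, h1, h2⟩ := p.exists_boundary_dart {x | x ∈ W.support} W.start_mem_support hv
    exact ⟨d.fst, d.snd, d.adj, h1, h2⟩
  nonneg _ _ h := (hy _ h.mem_stubPairs).1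
  le_one _ _ h := (hy _ h.mem_stubPairs).2

/-- The stubs of lengths `1 - y e` at the closed walk `W` come `δ`-close to all points. -/
structure IsFeasible {o : V} (W : G.Walk o o) (δ : ℝ) (y : V × V → ℝ) : Prop where
  mem_Icc : ∀ e ∈ stubPairs W, 0 ≤ y e ∧ y e ≤ 1
  gapsClose : GapsClose G (· ∈ W.support) (leaves W) (fun u v => y (u, v)) δ
  le_two_mul : ∀ e ∈ stubPairs W, e.2 ∈ W.support → y e ≤ 2 * δ

/-- The stubs at the two ends of an edge are merged into one, of length at most `1`; the gap is what
remains of the edge, and the cost does not grow. For an edge leaving the support,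
`IsGapData.gapsClose` applies. An edge with both ends visited is not recorded in the gap data and
needs a potential of its own. -/
theorem exists_isFeasible (hG : G.Connected) {δ : ℝ} (hδ : 0 ≤ δ) {a : V → V → ℝ}
    (ha : ∀ x y, 0 ≤ a x y ∧ a x y ≤ 1) {Q : Set (V → ℝ)} (hQ : Q ⊆ cover W a)
    (hd : ∀ p ∈ points G, setDist G p Q ≤ ENNReal.ofReal δ) :
    ∃ y, IsFeasible W δ y ∧ ∑ e ∈ stubPairs W, (1 - y e) ≤ ∑ x, ∑ y, a x y := by
  classical
  have hy : ∀ e ∈ stubPairs W, 0 ≤ max 0 (1 - (a e.1 e.2 + a e.2 e.1)) ∧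
      max 0 (1 - (a e.1 e.2 + a e.2 e.1)) ≤ 1 := fun e _ =>
    ⟨le_max_left _ _, max_le zero_le_one (by linarith [(ha e.1 e.2).1, (ha e.2 e.1).1])⟩
  refine ⟨fun e => max 0 (1 - (a e.1 e.2 + a e.2 e.1)), ⟨hy, ?_, ?_⟩, ?_⟩
  · refine (isGapData_of_walk hG hy).gapsClose hG (fun p hp => ?_) hδ hd
    obtain ⟨x, z, c, hxz, hc, rfl, h⟩ := hQ hp
    refine ⟨x, z, c, hxz, hc, rfl, ?_⟩
    rcases h with h | ⟨hx, h⟩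
    · exact Or.inl ⟨W.fst_mem_support_of_mem_edges h, W.snd_mem_support_of_mem_edges h⟩
    · by_cases hz : z ∈ W.support
      · exact Or.inl ⟨hx, hz⟩
      · refine Or.inr ⟨Or.inl ⟨hxz, hx, hz⟩, fun _ => ?_, fun h => absurd h.2.1 hz⟩
        rw [le_sub_comm]
        exact max_le (by linarith [hc.2]) (by linarith [(ha z x).1])
  · intro e he he2
    obtain ⟨hadj, hne, -, -⟩ := mem_stubPairs.1 he
    refine max_le (by linarith) ?_
    by_contra! hcon
    have ha1 := ha e.1 e.2
    have ha2 := ha e.2 e.1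
    -- A tent over the unvisited middle part of the edge, extended by zero to the other edges. Its
    -- height is half the length of that part, which would exceed `δ`.
    let k : ℝ → ℝ := fun t => max 0 (min (t - a e.1 e.2) (1 - a e.2 e.1 - t))
    have hk : ∀ s t, k s - k t ≤ |t - s| := by
      intro s t
      have h0 := abs_nonneg (t - s)
      have h1 := le_abs_self (t - s)
      have h2 := neg_abs_le (t - s)
      rw [sub_le_iff_le_add']
      refine max_le (add_nonneg (le_max_left _ _) h0) ?_
      have h3 : min (t - a e.1 e.2) (1 - a e.2 e.1 - t) ≤ k t := le_max_right _ _
      rw [min_le_iff]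
      rcases min_choice (t - a e.1 e.2) (1 - a e.2 e.1 - t) with h | h <;> rw [h] at h3
      · left; linarith
      · right; linarith
    have hk0 : k 0 = 0 := max_eq_left ((min_le_left _ _).trans (by linarith))
    have hk1 : k 1 = 0 := max_eq_left ((min_le_right _ _).trans (by linarith))
    have H : IsPotential G fun u v t =>
        if u = e.1 ∧ v = e.2 then k t else if u = e.2 ∧ v = e.1 then k (1 - t) else 0 := by
      refine ⟨fun u v t huv => ?_, ?_, fun u v huv s hs t ht => ?_⟩
      · by_cases h1 : u = e.1 ∧ v = e.2
        · have h2 : ¬ (v = e.1 ∧ u = e.2) := fun h => huv.ne (h1.1.trans h.1.symm)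
          rw [if_pos h1, if_neg h2, if_pos ⟨h1.2, h1.1⟩, sub_sub_cancel]
        · by_cases h2 : u = e.2 ∧ v = e.1
          · rw [if_neg h1, if_pos h2, if_pos ⟨h2.2, h2.1⟩]
          · rw [if_neg h1, if_neg h2, if_neg (fun h => h2 ⟨h.2, h.1⟩),
              if_neg (fun h => h1 ⟨h.2, h.1⟩)]
      · suffices ∀ u v, (if u = e.1 ∧ v = e.2 then k 0 else
            if u = e.2 ∧ v = e.1 then k (1 - 0) else 0) = 0 by
          intro u v v' _ _
          rw [this, this]
        intro u v
        rw [sub_zero, hk0, hk1]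
        simp
      · split_ifs
        · exact hk s t
        · refine (hk _ _).trans (le_of_eq ?_)
          rw [abs_sub_comm]; congr 1; ring
        · simp
    have := H.le_of_setDist_le (Q := Q) (fun p hp => ?_) hδ hadj
      (a := (1 + a e.1 e.2 - a e.2 e.1) / 2) ⟨by linarith, by linarith⟩
      (hd _ (edgePt_mem_points hadj ⟨by linarith, by linarith⟩))
    · rw [if_pos ⟨rfl, rfl⟩] at this
      have h2 := (le_max_right _ _).trans this
      rw [min_eq_left (by linarith)] at h2
      linarith
    · obtain ⟨x, z, c, hxz, hc, rfl, h⟩ := hQ hp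
      refine ⟨x, z, c, hxz, hc, rfl, ?_⟩
      split_ifs with h1 h2
      · rcases h with h | h
        · rw [h1.1, h1.2] at h; exact absurd h hne
        · rw [h1.1, h1.2] at h
          exact max_le le_rfl ((min_le_left _ _).trans (by linarith))
      · rcases h with h | h
        · rw [h2.1, h2.2, Sym2.eq_swap] at h; exact absurd h hne
        · rw [h2.1, h2.2] at h
          exact max_le le_rfl ((min_le_right _ _).trans (by linarith))
      · exact le_rfl
  · refine le_trans (Finset.sum_le_sum fun e _ => ?_)
      (sum_add_swap_le (W := W) (fun e => a e.1 e.2) fun e => (ha _ _).1)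
    dsimp only
    rw [Prod.fst_swap, Prod.snd_swap, sub_le_comm]
    exact le_max_right _ _

theorem IsFeasible.exists_rounding {δ : ℝ} {y : V × V → ℝ}
    (hy : IsFeasible W δ y) : ∃ y', IsFeasible W δ y' ∧
      (∀ e ∈ stubPairs W, y' e ∈ insert 1 (positions δ)) ∧
      ∑ e ∈ stubPairs W, (1 - y' e) ≤ ∑ e ∈ stubPairs W, (1 - y e) := by
  obtain ⟨Φ, hmono, hint, hadd, hgrid, hsum⟩ := ContinuousGraph.exists_rounding δ (stubPairs W) y
  have h0 : Φ 0 = 0 := by simpa using hint 0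
  have h1 : Φ 1 = 1 := by simpa using hint 1
  have hI : ∀ e ∈ stubPairs W, 0 ≤ Φ (y e) ∧ Φ (y e) ≤ 1 := fun e he =>
    ⟨h0 ▸ hmono (hy.mem_Icc e he).1, h1 ▸ hmono (hy.mem_Icc e he).2⟩
  refine ⟨fun e => Φ (y e), ⟨hI, hy.gapsClose.round hadd, fun e he he2 => ?_⟩,
    fun e he => mem_positions_of_mem_grid (hgrid _) (hI e he).1 (hI e he).2, ?_⟩
  -- The bound on a single gap is a two-term constraint whose second term `0` is fixed by `Φ`.
  · have := hadd (y e) 0 0 (by simpa using hy.le_two_mul e he he2)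
    simpa [h0] using this
  · rw [Finset.sum_sub_distrib, Finset.sum_sub_distrib]
    linarith

/-- Gaps of length `1` are filtered out because a stub must have positive length. They contribute
nothing to the sum, and the part they leave visited is a vertex of `W`. -/
theorem IsFeasible.exists_isDiscretized (hG : G.Connected) (hV : ∀ v : V, ∃ w, G.Adj v w)
    (hW : ∀ e, (open Classical in W.edges.count e) ≤ 2) {δ : ℝ} {y : V × V → ℝ}
    (hy : IsFeasible W δ y) (hpos : ∀ e ∈ stubPairs W, y e ∈ insert 1 (positions δ)) :
    ∃ T : Walk G, IsDiscretized G δ T ∧ T.length ∈ tourLengths V δ ∧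
      T.length = W.length + 2 * ∑ e ∈ stubPairs W, (1 - y e) := by
  classical
  have hmem : ∀ e ∈ (stubPairs W).filter (fun e => y e < 1), e ∈ stubPairs W ∧ y e < 1 :=
    fun e he => Finset.mem_filter.1 he
  have S : IsStubFamily W ((stubPairs W).filter (fun e => y e < 1)) (fun e => 1 - y e) :=
    { adj := fun e he => (mem_stubPairs.1 (hmem e he).1).1
      notMem_edges := fun e he => (mem_stubPairs.1 (hmem e he).1).2.1
      mem_support := fun e he => (mem_stubPairs.1 (hmem e he).1).2.2.1
      eq_of_edge := fun e he f hf => eq_of_mem_stubPairs (hmem e he).1 (hmem f hf).1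
      pos := fun e he => sub_pos.2 (hmem e he).2
      le_one := fun e he => by linarith [(hy.mem_Icc e (hmem e he).1).1] }
  obtain ⟨T, hT, hnice, hstops, hlen, hp1, hp2, hp3⟩ :=
    S.exists_tour (fun e => by convert hW e) (hV o)
  have hsum : ∑ e ∈ (stubPairs W).filter (fun e => y e < 1), (1 - y e) =
      ∑ e ∈ stubPairs W, (1 - y e) := by
    refine Finset.sum_subset (Finset.filter_subset _ _) fun e he hne => ?_
    have : ¬ y e < 1 := fun h => hne (Finset.mem_filter.2 ⟨he, h⟩)
    linarith [(hy.mem_Icc e he).2]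
  rw [hsum] at hlen
  have hp4 : ∀ e ∈ stubPairs W, ∀ c ∈ Set.Icc (0 : ℝ) (1 - y e),
      edgePt e.1 e.2 c ∈ T.passed := by
    intro e he c hc
    rcases (hy.mem_Icc e he).2.lt_or_eq with h | h
    · exact hp3 e (Finset.mem_filter.2 ⟨he, h⟩) c hc
    · rw [h, sub_self] at hc
      rw [le_antisymm hc.2 hc.1, edgePt_zero]
      exact hp1 _ (mem_stubPairs.1 he).2.2.1
  have hp0 : ∀ e ∈ stubPairs W, ∀ c ∈ Set.Icc (0 : ℝ) (1 - y e),
      setDist G (edgePt e.1 e.2 c) T.passed ≤ ENNReal.ofReal 0 := by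
    intro e he c hc
    rw [setDist_eq_zero (hp4 e he c hc) (edgePt_mem_points (mem_stubPairs.1 he).1
      ⟨hc.1, hc.2.trans (by linarith [(hy.mem_Icc e he).1])⟩)]
    exact zero_le
  have hUU : ∀ e ∈ stubPairs W, e.2 ∈ W.support → ∀ c ∈ Set.Icc (0 : ℝ) 1,
      setDist G (edgePt e.1 e.2 c) T.passed ≤ ENNReal.ofReal δ := by
    intro e he he2 c hc
    have hadj := (mem_stubPairs.1 he).1
    have hyI := hy.mem_Icc e he
    have hle := hy.le_two_mul e he he2
    have h0 : setDist G (edgePt e.1 e.2 1) T.passed ≤ ENNReal.ofReal 0 := by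
      rw [setDist_eq_zero (by rw [edgePt_one]; exact hp1 _ he2)
        (edgePt_mem_points hadj (by simp))]
      exact zero_le
    by_cases h1 : c ≤ 1 - y e
    · exact (hp0 e he c ⟨hc.1, h1⟩).trans (ENNReal.ofReal_le_ofReal (by linarith))
    -- Both ends of this gap are passed and its length is at most `2 * δ`, so one end is within `δ`.
    · by_cases h2 : c - (1 - y e) ≤ δ
      · refine setDist_edgePt_le hadj hc ⟨by linarith, by linarith⟩ le_rfl
          (hp0 e he (1 - y e) ⟨by linarith, le_rfl⟩) ?_
        rw [abs_of_nonpos (by linarith)]; linarith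
      · refine setDist_edgePt_le hadj hc (by simp) le_rfl h0 ?_
        rw [abs_of_nonneg (by linarith [hc.2])]; linarith
  refine ⟨T, ⟨⟨hT, ?_⟩, hnice, ?_⟩, ?_, hlen⟩
  · refine (isGapData_of_walk hG hy.mem_Icc).setDist_le hG (fun u v c huv hc hB h1 h2 => ?_)
      (fun u v h h' => absurd h'.2.1 h.2.2) (fun u v c huv hu hv hc => ?_) hy.gapsClose
    · rcases hB with hB | hB
      · exact hp4 (u, v) hB.mem_stubPairs c ⟨hc.1, h1 hB⟩
      · rw [edgePt_swap]
        exact hp4 (v, u) hB.mem_stubPairs (1 - c) ⟨by linarith [hc.2], by linarith [h2 hB]⟩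
    · have huse : ∀ x z, G.Adj x z → s(x, z) ∉ W.edges → x ∈ W.support →
          Fintype.equivFin V x < Fintype.equivFin V z → (x, z) ∈ stubPairs W :=
        fun x z h1 h2 h3 h4 => mem_stubPairs.2 ⟨h1, h2, h3, fun _ => h4⟩
      by_cases he : s(u, v) ∈ W.edges
      · rw [setDist_eq_zero (hp2 u v c hc he) (edgePt_mem_points huv hc)]
        exact zero_le
      · rcases lt_trichotomy (Fintype.equivFin V u) (Fintype.equivFin V v) with h | h | h
        · exact hUU _ (huse u v huv he hu h) hv c hc
        · exact absurd ((Fintype.equivFin V).injective h) huv.ne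
        · rw [edgePt_swap]
          exact hUU _ (huse v u huv.symm (by rwa [Sym2.eq_swap]) hv h) hu _ (one_sub_mem_Icc hc)
  · intro p hp
    rcases hstops p hp with ⟨v, rfl⟩ | ⟨e, he, rfl⟩
    · obtain ⟨w, hw⟩ := hV v
      exact ⟨v, w, 0, hw, Or.inl rfl, (edgePt_zero _ _).symm⟩
    · rw [edgePt_swap, sub_sub_cancel]
      exact exists_position (S.adj e he).symm (hpos e (hmem e he).1)
  · left
    refine ⟨W.length, ?_, fun e => if e ∈ stubPairs W then y e else 1, fun e => ?_, ?_⟩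
    · rw [← W.length_edges, ← List.sum_toFinset_count_eq_length, mul_comm, ← smul_eq_mul]
      refine (Finset.sum_le_card_nsmul _ _ 2 fun e _ => by convert hW e).trans ?_
      exact Nat.mul_le_mul_right _ (Finset.card_le_univ _)
    · dsimp only
      split_ifs with h
      · exact hpos e h
      · exact Or.inl rfl
    · rw [hlen]
      congr 2
      rw [← Finset.sum_subset (Finset.subset_univ (stubPairs W)) fun e _ he => by simp [he]]
      exact Finset.sum_congr rfl fun e he => by simp [he]

end

theorem exists_isDiscretized_of_vertex (hG : G.Connected) (hV : ∀ v : V, ∃ w, G.Adj v w) {δ : ℝ}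
    (hδ : 0 ≤ δ) {T : Walk G} (hT : IsDeltaTour G δ T) {k : ℕ} (hk : k ≤ T.len)
    (hv : IsVertex (T.pt k)) :
    ∃ T' : Walk G, IsDiscretized G δ T' ∧ T'.length ∈ tourLengths V δ ∧ T'.length ≤ T.length := by
  obtain ⟨o, ho⟩ := hv
  obtain ⟨W, a, ha, hcov, hlen⟩ := exists_closed_walk_cover hV hT.1 hk ho
  obtain ⟨W', h1, h2, h3, h4⟩ := exists_walk_count_le_two W
  have hcov' : T.passed ⊆ cover W' a := by
    intro p hp
    obtain ⟨x, y, c, h5, h6, h7, h8⟩ := hcov hp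
    exact ⟨x, y, c, h5, h6, h7, by rwa [h2, h3]⟩
  obtain ⟨y, hy, hysum⟩ := exists_isFeasible hG hδ ha hcov' hT.2
  obtain ⟨y', hy', hpos, hsum'⟩ := hy.exists_rounding
  obtain ⟨T', hT', hL, hlen'⟩ := hy'.exists_isDiscretized hG hV h4 hpos
  refine ⟨T', hT', hL, ?_⟩
  have : (W'.length : ℝ) ≤ W.length := by exact_mod_cast h1
  linarith

/-- There is a `δ`-tour for every `δ`: a closed walk through all edges. -/
theorem exists_isDiscretized (hG : G.Connected) (hV : ∀ v : V, ∃ w, G.Adj v w) (δ : ℝ) :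
    ∃ T : Walk G, IsDiscretized G δ T ∧ T.length ∈ tourLengths V δ := by
  classical
  obtain ⟨o⟩ := hG.nonempty
  have hS : ∀ S : Finset (V × V), ∃ W : G.Walk o o,
      ∀ e ∈ S, G.Adj e.1 e.2 → s(e.1, e.2) ∈ W.edges := by
    intro S
    induction S using Finset.induction_on with
    | empty => exact ⟨.nil, by simp⟩
    | insert e S he ih =>
      obtain ⟨W, hW⟩ := ih
      by_cases hadj : G.Adj e.1 e.2
      · obtain ⟨p⟩ := hG o e.1
        obtain ⟨q⟩ := hG e.2 o
        refine ⟨W.append (p.append (.cons hadj q)), fun f hf hfa => ?_⟩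
        simp only [SimpleGraph.Walk.edges_append, SimpleGraph.Walk.edges_cons, List.mem_append,
          List.mem_cons]
        rcases Finset.mem_insert.1 hf with rfl | hf
        · simp
        · exact Or.inl (hW f hf hfa)
      · refine ⟨W, fun f hf hfa => ?_⟩
        rcases Finset.mem_insert.1 hf with rfl | hf
        · exact absurd hfa hadj
        · exact hW f hf hfa
  obtain ⟨W, hW⟩ := hS Finset.univ
  obtain ⟨W', -, -, h3, h4⟩ := exists_walk_count_le_two W
  have hedge : ∀ u v, G.Adj u v → s(u, v) ∈ W'.edges := fun u v h =>
    (h3 _).2 (hW (u, v) (Finset.mem_univ _) h)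
  have hsupp : ∀ v, v ∈ W'.support := fun v => by
    obtain ⟨w, hw⟩ := hV v
    exact W'.fst_mem_support_of_mem_edges (hedge v w hw)
  have hempty : ∀ e, e ∉ stubPairs W' := fun e he =>
    (mem_stubPairs.1 he).2.1 (hedge _ _ (mem_stubPairs.1 he).1)
  have hF : IsFeasible W' δ (fun _ => 1) :=
    ⟨fun e he => absurd he (hempty e),
      ⟨fun u v h => absurd (hsupp v) h.2.2, fun u v _ hu => absurd (hsupp u) hu⟩,
      fun e he => absurd he (hempty e)⟩
  obtain ⟨T, hT, hL, -⟩ := hF.exists_isDiscretized hG hV h4 fun e he => absurd he (hempty e)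
  exact ⟨T, hT, hL⟩

/-! ### Tours inside an edge -/

/-- The tour from `p(u,v,a)` to `p(u,v,b)` and back. -/
def Walk.backForth {V : Type*} {G : SimpleGraph V} {u v : V} {a b : ℝ} (h : G.Adj u v)
    (ha : a ∈ Set.Icc (0 : ℝ) 1) (hb : b ∈ Set.Icc (0 : ℝ) 1) (hab : a ≠ b) : Walk G where
  len := 2
  pt i := edgePt u v (if i = 1 then b else a)
  mem_points i _ := edgePt_mem_points h (by split_ifs <;> assumption)
  step i hi := by
    obtain rfl | rfl : i = 0 ∨ i = 1 := by omega
    · exact ⟨u, v, a, b, h, ha, hb, hab, by simp, by simp⟩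
    · exact ⟨u, v, b, a, h, hb, ha, hab.symm, by simp, by simp⟩

/-- An interval that shrinks to a point needs the tour without steps, since steps join distinct
points. -/
theorem exists_tour_in_edge {u v : V} {a b : ℝ} (h : G.Adj u v) (ha : a ∈ Set.Icc (0 : ℝ) 1)
    (hb : b ∈ Set.Icc (0 : ℝ) 1) (hab : a ≤ b) :
    ∃ T : Walk G, T.IsTour ∧ T.stops ⊆ {edgePt u v a, edgePt u v b} ∧
      (∀ c ∈ Set.Icc a b, edgePt u v c ∈ T.passed) ∧ T.length = 2 * (b - a) := by
  rcases hab.lt_or_eq with hab | rfl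
  · refine ⟨Walk.backForth h ha hb hab.ne, rfl, ?_, fun c hc => ?_, ?_⟩
    · rintro p ⟨i, -, rfl⟩
      change edgePt u v (if i = 1 then b else a) ∈ _
      split_ifs
      · exact Or.inr rfl
      · exact Or.inl rfl
    · exact Or.inr ⟨0, two_pos, u, v, a, b, c, h, ha, hb, rfl, rfl, (min_le_left _ _).trans hc.1,
        hc.2.trans (le_max_right _ _), rfl⟩
    · change ∑ i ∈ Finset.range 2, edgeDist (edgePt u v (if i = 1 then b else a))
        (edgePt u v (if i + 1 = 1 then b else a)) = _
      simp only [edgeDist_edgePt h.ne, Finset.sum_range_succ, Finset.sum_range_zero]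
      norm_num
      rw [abs_of_pos (by linarith), abs_of_neg (by linarith)]
      ring
  · refine ⟨Walk.single _ (edgePt_mem_points h ha), rfl, ?_, fun c hc => ?_, ?_⟩
    · rintro p ⟨i, -, rfl⟩
      exact Or.inl rfl
    · rw [le_antisymm hc.2 hc.1]
      exact Or.inl ⟨0, le_rfl, rfl⟩
    · simp [Walk.length, Walk.single]

/-- No vertex counts as visited, and the single edge `uv` carries two gaps: one of length `α` at `u`
and one of length `1 - β` at `v`. The same inequalities and the same rounding apply. -/
theorem exists_isDiscretized_of_no_vertex (hG : G.Connected) {δ : ℝ} (hδ : 0 ≤ δ) {T : Walk G}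
    (hT : IsDeltaTour G δ T) (hv : ∀ i ≤ T.len, ¬ IsVertex (T.pt i)) :
    ∃ T' : Walk G, IsDiscretized G δ T' ∧ T'.length ∈ tourLengths V δ ∧ T'.length ≤ T.length := by
  classical
  obtain ⟨u, v, α, β, huv, hα, hαβ, hβ, hpass, hlen⟩ := exists_interval_of_no_vertex hT.1 hv
  let B : V → V → Prop := fun x w => (x = u ∧ w = v) ∨ (x = v ∧ w = u)
  let gaps : ℝ → ℝ → V → V → ℝ := fun r s x _ => if x = u then s else r
  have hvu : ¬ v = u := huv.ne'
  have D : ∀ r s, r ∈ Set.Icc (0 : ℝ) 1 → s ∈ Set.Icc (0 : ℝ) 1 →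
      IsGapData G (fun _ => False) B (gaps r s) := by
    intro r s hr hs
    refine ⟨?_, fun _ _ _ h => h, fun _ _ _ h => h.elim, ?_, fun _ _ => ⟨u, v, Or.inl ⟨rfl, rfl⟩⟩,
      ?_, ?_⟩
    · rintro x w (⟨rfl, rfl⟩ | ⟨rfl, rfl⟩)
      · exact huv
      · exact huv.symm
    · rintro x w (⟨rfl, rfl⟩ | ⟨rfl, rfl⟩)
      · exact Or.inr (Or.inr ⟨rfl, rfl⟩)
      · exact Or.inr (Or.inl ⟨rfl, rfl⟩)
    · intro x w _
      change 0 ≤ ite _ _ _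
      split_ifs
      · exact hs.1
      · exact hr.1
    · intro x w _
      change ite _ _ _ ≤ (1 : ℝ)
      split_ifs
      · exact hs.2
      · exact hr.2
  have g1 : ∀ r s, gaps r s u v = s := fun r s => if_pos rfl
  have g2 : ∀ r s, gaps r s v u = r := fun r s => if_neg hvu
  have hBuv : B u v := Or.inl ⟨rfl, rfl⟩
  have hBvu : B v u := Or.inr ⟨rfl, rfl⟩
  have hαI : α ∈ Set.Icc (0 : ℝ) 1 := ⟨hα, hαβ.trans hβ⟩
  have hβI : 1 - β ∈ Set.Icc (0 : ℝ) 1 := ⟨by linarith, by linarith⟩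
  have hc : GapsClose G (fun _ => False) B (gaps α (1 - β)) δ := by
    refine (D _ _ hαI hβI).gapsClose hG (fun p hp => ?_) hδ hT.2
    obtain ⟨c, h1, h2, rfl⟩ := hpass p hp
    refine ⟨u, v, c, huv, ⟨hα.trans h1, h2.trans hβ⟩, rfl, Or.inr ⟨Or.inl hBuv, fun _ => ?_,
      fun _ => ?_⟩⟩
    · rw [g1]; linarith
    · rw [g2]; exact h1
  obtain ⟨Φ, hmono, hint, hadd, hgrid, hsum⟩ :=
    exists_rounding δ Finset.univ (fun i : Bool => if i then α else 1 - β)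
  have h0 : Φ 0 = 0 := by simpa using hint 0
  have h1 : Φ 1 = 1 := by simpa using hint 1
  have hΦI : ∀ r ∈ Set.Icc (0 : ℝ) 1, Φ r ∈ Set.Icc (0 : ℝ) 1 := fun r hr =>
    ⟨h0 ▸ hmono hr.1, h1 ▸ hmono hr.2⟩
  have hpos : ∀ r ∈ Set.Icc (0 : ℝ) 1, Φ r ∈ insert 1 (positions δ) := fun r hr =>
    mem_positions_of_mem_grid (hgrid r) (hΦI r hr).1 (hΦI r hr).2
  simp only [Fintype.sum_bool, if_true, Bool.false_eq_true, if_false] at hsum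
  -- The rounded gaps may exceed `1` in total. The second is then cut down, which keeps the
  -- inequalities, and the tour becomes a single point at position `Φ α`.
  obtain ⟨s, hs, hs1, hs2⟩ : ∃ s, s ≤ Φ (1 - β) ∧ s ≤ 1 - Φ α ∧
      (s = Φ (1 - β) ∨ s = 1 - Φ α) :=
    ⟨min (Φ (1 - β)) (1 - Φ α), min_le_left _ _, min_le_right _ _, min_choice _ _⟩
  have hΦα := hΦI α hαI
  have hΦβ := hΦI _ hβI
  have hsI : s ∈ Set.Icc (0 : ℝ) 1 := by
    rcases hs2 with h | h
    · rw [h]; exact hΦβ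
    · rw [h]; exact one_sub_mem_Icc hΦα
  have hc' : GapsClose G (fun _ => False) B (gaps (Φ α) s) δ := by
    refine (hc.round hadd).mono fun x w _ => ?_
    change ite _ _ _ ≤ Φ (ite _ _ _)
    split_ifs
    · exact hs
    · exact le_rfl
  obtain ⟨T', ht, hstops, hpassed, hlen'⟩ := exists_tour_in_edge huv hΦα (one_sub_mem_Icc hsI)
    (show Φ α ≤ 1 - s by linarith)
  have hcard : T'.stops.ncard ≤ 2 := (Set.ncard_le_ncard hstops (Set.toFinite _)).trans
    ((Set.ncard_insert_le _ _).trans (by simp))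
  refine ⟨T', ⟨⟨ht, ?_⟩, Or.inr hcard, ?_⟩, ?_, ?_⟩
  · refine (D _ _ hΦα hsI).setDist_le hG ?_ ?_ (fun _ _ _ _ h => h.elim) hc'
    · intro x w c hxw hc hB h2 h3
      obtain ⟨rfl, rfl⟩ | ⟨rfl, rfl⟩ : (x = u ∧ w = v) ∨ (x = v ∧ w = u) := by
        simp only [B] at hB
        tauto
      · have h2 := h2 hBuv
        have h3 := h3 hBvu
        rw [g1] at h2
        rw [g2] at h3
        exact hpassed c ⟨h3, h2⟩
      · have h2 := h2 hBvu
        have h3 := h3 hBuv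
        rw [g2] at h2
        rw [g1] at h3
        rw [edgePt_swap]
        exact hpassed _ ⟨by linarith, by linarith⟩
    · rintro x w (⟨rfl, rfl⟩ | ⟨rfl, rfl⟩) -
      · rw [g1, g2]; linarith
      · rw [g1, g2]; linarith
  · intro p hp
    rcases hstops hp with rfl | rfl
    · exact exists_position huv (hpos α hαI)
    · rcases hs2 with h | h
      · rw [edgePt_swap, sub_sub_cancel, h]
        exact exists_position huv.symm (hpos _ hβI)
      · rw [h, sub_sub_cancel]
        exact exists_position huv (hpos α hαI)
  · rcases hs2 with h | h
    · right
      exact ⟨Φ α, hpos α hαI, Φ (1 - β), hpos _ hβI, by rw [hlen', h]; ring⟩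
    · left
      exact ⟨0, Nat.zero_le _, fun _ => 1, fun _ => Or.inl rfl, by rw [hlen', h]; simp⟩
  · rw [hlen']
    rcases hs2 with h | h
    · rw [h]; linarith
    · rw [h]; linarith

end

end ContinuousGraph

end

/-! ### Existence of a shortest tour -/

theorem mainTheorem9 {V : Type*} [Fintype V] [Nontrivial V] (G : SimpleGraph V)
    (hG : G.Connected) (δ : ℝ) (hδ : 0 ≤ δ) :
    ∃ T : ContinuousGraph.Walk G,
      ContinuousGraph.IsShortestDeltaTour G δ T ∧
      (T.IsNice ∨ T.stops.ncard ≤ 2) ∧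
      ∀ p ∈ T.stops, ∃ (u v : V) (lam : ℝ), G.Adj u v ∧
        lam ∈ ContinuousGraph.positions δ ∧ p = ContinuousGraph.edgePt u v lam := by
  have hV : ∀ v : V, ∃ w, G.Adj v w := fun v => hG.preconnected.exists_adj_of_nontrivial v
  have hfin : {L | L ∈ ContinuousGraph.tourLengths V δ ∧
      ∃ T : ContinuousGraph.Walk G, ContinuousGraph.IsDiscretized G δ T ∧ T.length = L}.Finite :=
    (ContinuousGraph.tourLengths_finite V δ).subset fun L hL => hL.1
  obtain ⟨T₀, hT₀, hL₀⟩ := ContinuousGraph.exists_isDiscretized hG hV δ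
  -- The minimum is taken over finitely many lengths of discretized tours; it is a minimum over all
  -- `δ`-tours because each of them is at least as long as one of these.
  obtain ⟨L, ⟨-, T, hT, rfl⟩, hmin⟩ := Set.exists_min_image _ id hfin ⟨_, hL₀, T₀, hT₀, rfl⟩
  refine ⟨T, ⟨hT.isDeltaTour, fun T' hT' => ?_⟩, hT.isNice_or, hT.positions⟩
  obtain ⟨T'', h1, h2, h3⟩ : ∃ T'' : ContinuousGraph.Walk G,
      ContinuousGraph.IsDiscretized G δ T'' ∧ T''.length ∈ ContinuousGraph.tourLengths V δ ∧
      T''.length ≤ T'.length := by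
    by_cases hv : ∃ k ≤ T'.len, ContinuousGraph.IsVertex (T'.pt k)
    · obtain ⟨k, hk, hv⟩ := hv
      exact ContinuousGraph.exists_isDiscretized_of_vertex hG hV hδ hT' hk hv
    · push Not at hv
      exact ContinuousGraph.exists_isDiscretized_of_no_vertex hG hδ hT' hv
  exact (hmin _ ⟨h2, T'', h1, rfl⟩).trans h3
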